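/- Let $\mathbb{K}$ be a field, let $q\in\mathbb{K}$ be nonzero and not a root of unity, and let $\rho\in\mathbb{K}$ be nonzero. Write $[X,Y]=XY-YX$ and $[X,Y]_q=qXY-q^{-1}YX$. Let $\mathcal{A}_q$ be the associative unital $\mathbb{K}$-algebra with generators $\mathcal{W}_{-k},\mathcal{W}_{k+1},\mathcal{G}_{k+1},\tilde{\mathcal{G}}_{k+1}$ ($k\ge 0$) and the defining relations below. For indeterminates $u,v$ put $U=U(u)=\dfrac{qu^2+q^{-1}u^{-2}}{q+q^{-1}}$, $V=U(v)$, and $$\mathcal{W}_+(u)=\sum_{k\ge0}\mathcal{W}_{-k}U^{-k-1},\quad \mathcal{W}_-(u)=\sum_{k\ge0}\mathcal{W}_{k+1}U^{-k-1},\quad \mathcal{G}_+(u)=\sum_{k\ge0}\mathcal{G}_{k+1}U^{-k-1},\quad \mathcal{G}_-(u)=\sum_{k\ge0}\tilde{\mathcal{G}}_{k+1}U^{-k-1}.$$ The defining relations are the following identities of formal series in the variables $U^{-1},V^{-1}$ (for both choices of sign, upper and lower signs being taken together, and for $\epsilon=\pm$ independently): $$[\mathcal{W}_\pm(u),\mathcal{W}_\pm(v)]=0,\qquad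 [\mathcal{W}_+(u),\mathcal{W}_-(v)]+[\mathcal{W}_-(u),\mathcal{W}_+(v)]=0,$$ $$(U-V)[\mathcal{W}_\pm(u),\mathcal{W}_\mp(v)]=\tfrac{q-q^{-1}}{\rho(q+q^{-1})}\big(\mathcal{G}_\pm(u)\mathcal{G}_\mp(v)-\mathcal{G}_\pm(v)\mathcal{G}_\mp(u)\big)+\tfrac{1}{q+q^{-1}}\big(\mathcal{G}_\pm(u)-\mathcal{G}_\mp(u)+\mathcal{G}_\mp(v)-\mathcal{G}_\pm(v)\big),$$ $$\mathcal{W}_\pm(u)\mathcal{W}_\pm(v)-\mathcal{W}_\mp(u)\mathcal{W}_\mp(v)+\tfrac{1}{\rho(q^2-q^{-2})}[\mathcal{G}_\pm(u),\mathcal{G}_\mp(v)]+\tfrac{1-UV}{U-V}\big(\mathcal{W}_\pm(u)\mathcal{W}_\mp(v)-\mathcal{W}_\pm(v)\mathcal{W}_\mp(u)\big)=0,$$ $$U[\mathcal{G}_\mp(v),\mathcal{W}_\pm(u)]_q-V[\mathcal{G}_\mp(u),\mathcal{W}_\pm(v)]_q-(q-q^{-1})\big(\mathcal{W}_\mp(u)\mathcal{G}_\mp(v)-\mathcal{W}_\mp(v)\mathcal{G}_\mp(u)\big)+\rho\big(U\mathcal{W}_\pm(u)-V\mathcal{W}_\pm(v)-\mathcal{W}_\mp(u)+\mathcal{W}_\mp(v)\big)=0,$$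 $$U[\mathcal{W}_\mp(u),\mathcal{G}_\mp(v)]_q-V[\mathcal{W}_\mp(v),\mathcal{G}_\mp(u)]_q-(q-q^{-1})\big(\mathcal{W}_\pm(u)\mathcal{G}_\mp(v)-\mathcal{W}_\pm(v)\mathcal{G}_\mp(u)\big)+\rho\big(U\mathcal{W}_\mp(u)-V\mathcal{W}_\mp(v)-\mathcal{W}_\pm(u)+\mathcal{W}_\pm(v)\big)=0,$$ $$[\mathcal{G}_\epsilon(u),\mathcal{W}_\pm(v)]+[\mathcal{W}_\pm(u),\mathcal{G}_\epsilon(v)]=0,\qquad [\mathcal{G}_\pm(u),\mathcal{G}_\pm(v)]=0,\qquad [\mathcal{G}_+(u),\mathcal{G}_-(v)]+[\mathcal{G}_-(u),\mathcal{G}_+(v)]=0.$$ Define $$\begin{aligned}\Delta(u)=&-(q-q^{-1})(q^2+q^{-2})\big(\mathcal{W}_+(u)\mathcal{W}_+(uq)+\mathcal{W}_-(u)\mathcal{W}_-(uq)\big)-\tfrac{q-q^{-1}}{\rho}\big(\mathcal{G}_+(u)\mathcal{G}_-(uq)+\mathcal{G}_-(u)\mathcal{G}_+(uq)\big)\\&+(q-q^{-1})(u^2q^2+u^{-2}q^{-2})\big(\mathcal{W}_+(u)\mathcal{W}_-(uq)+\mathcal{W}_-(u)\mathcal{W}_+(uq)\big)-\mathcal{G}_+(u)-\mathcal{G}_+(uq)-\mathcal{G}_-(u)-\mathcal{G}_-(uq).\end{aligned}$$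 Expand $\Delta(u)$ and the currents in $v$ as formal Laurent series with coefficients in $\mathcal{A}_q$, each of $u$, $v$ being expanded about $\infty$ or about $0$. Then $$[\Delta(u),\mathcal{W}_\pm(v)]=[\Delta(u),\mathcal{G}_\pm(v)]=0,$$ and every coefficient of $\Delta(u)$ lies in the center of $\mathcal{A}_q$. -/

import Mathlib

noncomputable section

namespace AqAlgebra

/-! ### Formal series with non-commutative coefficients -/

section Series

variable {A : Type*} [Ring A]

/-- Laurent series in two independent (central) variables `x`, `y` with coefficients in `A`:
the outer variable is `x`, the inner variable is `y`. -/
abbrev Laurent₂ (A : Type*) [Ring A] : Type _ := LaurentSeries (LaurentSeries A)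

/-- A one-variable series, regarded as a series in the first variable. -/
def inFst (f : LaurentSeries A) : Laurent₂ A :=
  HahnSeries.map f (HahnSeries.C : A →+* LaurentSeries A)

/-- A one-variable series, regarded as a series in the second variable. -/
def inSnd (f : LaurentSeries A) : Laurent₂ A := HahnSeries.C f

/-- The variable of a ring of Laurent series. -/
def var (A : Type*) [Ring A] : LaurentSeries A := HahnSeries.single 1 1

/-- The inverse of the variable of a ring of Laurent series. -/
def varInv (A : Type*) [Ring A] : LaurentSeries A := HahnSeries.single (-1) 1

/-- The formal series `∑_{k ≥ 0} a_k x^{k+1}`. -/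
def formalCurrent (a : ℕ → A) : LaurentSeries A :=
  HahnSeries.ofPowerSeries ℤ A (PowerSeries.X * PowerSeries.mk a)

variable {K : Type*} [Field K] [Algebra K A]

/-- The `q`-commutator `[X, Y]_q = q X Y - q⁻¹ Y X`. -/
def qComm {B : Type*} [Ring B] [Module K B] (q : K) (X Y : B) : B :=
  q • (X * Y) - q⁻¹ • (Y * X)

/-- The series `∑_{k ≥ 0} a_k T^{k+1}`, for a scalar Laurent series `T` without terms of
degree `≤ 0`. As `T^{k+1}` has no terms of degree `≤ k`, only the summands with `k < n` contribute
to the coefficient of degree `n`; see `coeff_currentAt`. -/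
def currentAt (a : ℕ → A) (T : LaurentSeries K) : LaurentSeries A :=
  HahnSeries.ofPowerSeries ℤ A
    (PowerSeries.mk fun n => ∑ k ∈ Finset.range n, (T ^ (k + 1)).coeff (n : ℤ) • a k)

/-- The definition of `currentAt` omits only terms that vanish: its coefficient of degree `n` is
the full sum over `k` of the coefficients of `a_k T^{k+1}`. -/
theorem coeff_currentAt (a : ℕ → A) (T : LaurentSeries K) (hT : ((1 : ℤ) : WithTop ℤ) ≤ T.orderTop)
    (n : ℤ) : (currentAt a T).coeff n = ∑ᶠ k : ℕ, (T ^ (k + 1)).coeff n • a k := by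
  have key : ∀ (k : ℕ) (n : ℤ), n < (k : ℤ) + 1 → (T ^ (k + 1)).coeff n = 0 := by
    intro k n hn
    apply HahnSeries.coeff_eq_zero_of_lt_orderTop
    refine lt_of_lt_of_le ?_
      (HahnSeries.orderTop_nsmul_le_orderTop_pow (x := T) (n := k + 1))
    refine lt_of_lt_of_le ?_ (nsmul_le_nsmul_right hT (k + 1))
    rw [← WithTop.coe_nsmul, WithTop.coe_lt_coe]
    simpa using hn
  rcases lt_or_ge n 0 with hn | hn
  · rw [currentAt, HahnSeries.ofPowerSeries_apply, HahnSeries.embDomain_of_notMem_range]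
    · rw [finsum_eq_zero_of_forall_eq_zero]
      intro k
      rw [key k n (by omega), zero_smul]
    · rintro ⟨m, hm⟩
      have : (m : ℤ) = n := hm
      omega
  · lift n to ℕ using hn
    rw [currentAt, HahnSeries.ofPowerSeries_apply_coeff, PowerSeries.coeff_mk]
    symm
    apply finsum_eq_sum_of_support_subset
    intro k hk
    simp only [Finset.coe_range, Set.mem_Iio]
    by_contra hlt
    exact hk (by simp only [key k n (by omega), zero_smul])

/-- A scalar Laurent series, regarded as a Laurent series with coefficients in `A`. -/
def scalar (A : Type*) [Ring A] [Algebra K A] (f : LaurentSeries K) : LaurentSeries A :=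
  HahnSeries.map f (algebraMap K A)

/-- `U(u) = (q u² + q⁻¹ u⁻²) / (q + q⁻¹)`, for a spectral parameter `u` in a field of Laurent
series. -/
def spectral (q : K) (u : LaurentSeries K) : LaurentSeries K :=
  (HahnSeries.C q * u ^ 2 + HahnSeries.C q⁻¹ * (u⁻¹) ^ 2) / HahnSeries.C (q + q⁻¹)

/-- `U(u)⁻¹` has no terms of degree `≤ 0` when `u` is a nonzero multiple of `x` or of `x⁻¹`. -/
theorem one_le_orderTop_spectral_inv (q c : K) (hq0 : q ≠ 0) (hc : c ≠ 0)
    (u : LaurentSeries K) (hu : u = varInv K * HahnSeries.C c ∨ u = var K * HahnSeries.C c) :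
    ((1 : ℤ) : WithTop ℤ) ≤ ((spectral q u)⁻¹).orderTop := by
  have single_inv : ∀ (m : ℤ) (d : K), (HahnSeries.single m d : LaurentSeries K)⁻¹
      = HahnSeries.single (-m) d⁻¹ := fun m d => HahnSeries.inv_single m d
  set N : LaurentSeries K := HahnSeries.C q * u ^ 2 + HahnSeries.C q⁻¹ * (u⁻¹) ^ 2 with hN
  have hNc : N.coeff (-2) ≠ 0 := by
    rcases hu with rfl | rfl <;>
    · simp only [hN, varInv, var, HahnSeries.C_apply, HahnSeries.single_mul_single, single_inv,
        HahnSeries.single_pow]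
      simp [hq0, hc]
  have hNo : N.orderTop ≤ ((-2 : ℤ) : WithTop ℤ) := HahnSeries.orderTop_le_of_coeff_ne_zero hNc
  have hN0 : N ≠ 0 := by
    rintro h
    simp [h] at hNc
  have hmul : (spectral q u)⁻¹ * N = HahnSeries.C (q + q⁻¹) := by
    rw [spectral, ← hN, inv_div, div_mul_cancel₀ _ hN0]
  have ho := congrArg HahnSeries.orderTop hmul
  rw [HahnSeries.orderTop_mul] at ho
  have hC : (0 : WithTop ℤ) ≤ (HahnSeries.C (q + q⁻¹) : LaurentSeries K).orderTop :=
    HahnSeries.orderTop_single_le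
  rw [← ho] at hC
  generalize (spectral q u)⁻¹.orderTop = t at hC ⊢
  generalize N.orderTop = s at hC hNo
  induction t using WithTop.recTopCoe with
  | top => exact le_top
  | coe t =>
    induction s using WithTop.recTopCoe with
    | top => simp at hNo
    | coe s =>
      rw [← WithTop.coe_add, ← WithTop.coe_zero, WithTop.coe_le_coe] at hC
      rw [WithTop.coe_le_coe] at hNo ⊢
      omega

end Series

/-! ### The algebra -/

/-- The generators. For the upper sign, `W 1 k` is `𝒲_{-k}` and `G 1 k` is `𝒢_{k+1}`;
for the lower sign, `W (-1) k` is `𝒲_{k+1}` and `G (-1) k` is `𝒢̃_{k+1}` (`k ≥ 0`). -/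
inductive Gen : Type
  | W (ε : ℤˣ) (k : ℕ)
  | G (ε : ℤˣ) (k : ℕ)

section Relations

variable (K : Type*) [Field K]

/-- The current `𝒲_ε` as a formal series in `U⁻¹` over the free algebra. -/
def freeW (ε : ℤˣ) : LaurentSeries (FreeAlgebra K Gen) :=
  formalCurrent fun k => FreeAlgebra.ι K (Gen.W ε k)

/-- The current `𝒢_ε` as a formal series in `U⁻¹` over the free algebra. -/
def freeG (ε : ℤˣ) : LaurentSeries (FreeAlgebra K Gen) :=
  formalCurrent fun k => FreeAlgebra.ι K (Gen.G ε k)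

/-- `𝒲_ε(u)`: the first variable of `Laurent₂` stands for `U⁻¹`. -/
def Wu (ε : ℤˣ) : Laurent₂ (FreeAlgebra K Gen) := inFst (freeW K ε)
/-- `𝒲_ε(v)`: the second variable of `Laurent₂` stands for `V⁻¹`. -/
def Wv (ε : ℤˣ) : Laurent₂ (FreeAlgebra K Gen) := inSnd (freeW K ε)
/-- `𝒢_ε(u)` -/
def Gu (ε : ℤˣ) : Laurent₂ (FreeAlgebra K Gen) := inFst (freeG K ε)
/-- `𝒢_ε(v)` -/
def Gv (ε : ℤˣ) : Laurent₂ (FreeAlgebra K Gen) := inSnd (freeG K ε)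
/-- The variable `U`, inverse of the first variable of `Laurent₂`. -/
def UU : Laurent₂ (FreeAlgebra K Gen) := inFst (varInv (FreeAlgebra K Gen))
/-- The variable `V`, inverse of the second variable of `Laurent₂`. -/
def VV : Laurent₂ (FreeAlgebra K Gen) := inSnd (varInv (FreeAlgebra K Gen))

variable {K}

/-- The defining relations of `𝒜_q`, as identities `lhs = rhs` between formal series in
`U⁻¹, V⁻¹`. The sign `ε` is the upper one of each `±`, and `-ε` is the upper one of each `∓`.
The relation `ww_gg`, in which the factor `(1 - UV)/(U - V)` occurs, is multiplied by `U - V`;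
this is not a zero divisor, so that the ideal generated by the coefficients is unchanged. -/
inductive CurrentRel (q ρ : K) :
    Laurent₂ (FreeAlgebra K Gen) → Laurent₂ (FreeAlgebra K Gen) → Prop
  | ww_same (ε : ℤˣ) : CurrentRel q ρ ⁅Wu K ε, Wv K ε⁆ 0
  | ww_mixed : CurrentRel q ρ (⁅Wu K 1, Wv K (-1)⁆ + ⁅Wu K (-1), Wv K 1⁆) 0
  | ww_comm (ε : ℤˣ) : CurrentRel q ρ
      ((UU K - VV K) * ⁅Wu K ε, Wv K (-ε)⁆)
      (((q - q⁻¹) / (ρ * (q + q⁻¹))) • (Gu K ε * Gv K (-ε) - Gv K ε * Gu K (-ε))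
        + (1 / (q + q⁻¹)) • (Gu K ε - Gu K (-ε) + Gv K (-ε) - Gv K ε))
  | ww_gg (ε : ℤˣ) : CurrentRel q ρ
      ((UU K - VV K) * (Wu K ε * Wv K ε - Wu K (-ε) * Wv K (-ε)
          + (1 / (ρ * (q ^ 2 - (q⁻¹) ^ 2))) • ⁅Gu K ε, Gv K (-ε)⁆)
        + (1 - UU K * VV K) * (Wu K ε * Wv K (-ε) - Wv K ε * Wu K (-ε))) 0
  | gw_q (ε : ℤˣ) : CurrentRel q ρ
      (UU K * qComm q (Gv K (-ε)) (Wu K ε) - VV K * qComm q (Gu K (-ε)) (Wv K ε)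
        - (q - q⁻¹) • (Wu K (-ε) * Gv K (-ε) - Wv K (-ε) * Gu K (-ε))
        + ρ • (UU K * Wu K ε - VV K * Wv K ε - Wu K (-ε) + Wv K (-ε))) 0
  | wg_q (ε : ℤˣ) : CurrentRel q ρ
      (UU K * qComm q (Wu K (-ε)) (Gv K (-ε)) - VV K * qComm q (Wv K (-ε)) (Gu K (-ε))
        - (q - q⁻¹) • (Wu K ε * Gv K (-ε) - Wv K ε * Gu K (-ε))
        + ρ • (UU K * Wu K (-ε) - VV K * Wv K (-ε) - Wu K ε + Wv K ε)) 0
  | gw_comm (η ε : ℤˣ) : CurrentRel q ρ (⁅Gu K η, Wv K ε⁆ + ⁅Wu K ε, Gv K η⁆) 0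
  | gg_same (ε : ℤˣ) : CurrentRel q ρ ⁅Gu K ε, Gv K ε⁆ 0
  | gg_mixed : CurrentRel q ρ (⁅Gu K 1, Gv K (-1)⁆ + ⁅Gu K (-1), Gv K 1⁆) 0

/-- Relations between elements of the free algebra: corresponding coefficients of the two sides
of the current relations. -/
inductive CoeffRel (q ρ : K) : FreeAlgebra K Gen → FreeAlgebra K Gen → Prop
  | of {f g : Laurent₂ (FreeAlgebra K Gen)} (h : CurrentRel q ρ f g) (m n : ℤ) :
      CoeffRel q ρ ((f.coeff m).coeff n) ((g.coeff m).coeff n)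

/-- The associative unital `K`-algebra `𝒜_q`, with parameters `q` and `ρ`, by generators and
relations. -/
abbrev Aq (q ρ : K) : Type _ := RingQuot (CoeffRel q ρ)

/-- The class of a generator in `𝒜_q`. -/
def gen (q ρ : K) (g : Gen) : Aq q ρ :=
  RingQuot.mkAlgHom K (CoeffRel q ρ) (FreeAlgebra.ι K g)

end Relations

/-! ### The currents and the generating function -/

section Currents

variable {K : Type*} [Field K] (q ρ : K)

/-- `𝒲_ε(u) = ∑_k 𝒲_• U(u)^{-k-1}` with coefficients in `𝒜_q`, expanded in the variable of the
field of Laurent series in which the spectral parameter `u` lies. -/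
def currentW (ε : ℤˣ) (u : LaurentSeries K) : LaurentSeries (Aq q ρ) :=
  currentAt (fun k => gen q ρ (Gen.W ε k)) (spectral q u)⁻¹

/-- `𝒢_ε(u) = ∑_k 𝒢_• U(u)^{-k-1}` with coefficients in `𝒜_q`. -/
def currentG (ε : ℤˣ) (u : LaurentSeries K) : LaurentSeries (Aq q ρ) :=
  currentAt (fun k => gen q ρ (Gen.G ε k)) (spectral q u)⁻¹

/-- The shifted spectral parameter `u q`. -/
def shift (u : LaurentSeries K) : LaurentSeries K := u * HahnSeries.C q

/-- The generating function `Δ(u)`. -/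
def Delta (u : LaurentSeries K) : LaurentSeries (Aq q ρ) :=
  -(((q - q⁻¹) * (q ^ 2 + (q⁻¹) ^ 2)) •
      (currentW q ρ 1 u * currentW q ρ 1 (shift q u)
        + currentW q ρ (-1) u * currentW q ρ (-1) (shift q u)))
  - ((q - q⁻¹) / ρ) •
      (currentG q ρ 1 u * currentG q ρ (-1) (shift q u)
        + currentG q ρ (-1) u * currentG q ρ 1 (shift q u))
  + (q - q⁻¹) • (scalar (Aq q ρ) ((shift q u) ^ 2 + ((shift q u)⁻¹) ^ 2) *
      (currentW q ρ 1 u * currentW q ρ (-1) (shift q u)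
        + currentW q ρ (-1) u * currentW q ρ 1 (shift q u)))
  - currentG q ρ 1 u - currentG q ρ 1 (shift q u)
  - currentG q ρ (-1) u - currentG q ρ (-1) (shift q u)

end Currents

end AqAlgebra

end

/-! The series `Delta` is, up to a nonzero factor and an additive constant, the Sklyanin determinant
of a `K`-matrix built from the currents, and such determinants commute with the `K`-matrix by the
fusion argument for reflection algebras.

In detail, the currents at a point form a 2×2 matrix `kMat`, and the defining relations at two
points imply Sklyanin's reflection equation for the six-vertex `R`-matrix
(`reflectionEq_of_exchangeRel`). Fusing the `K`-matrices at `u` and `uq` gives an operator T on two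
spaces that passes through `K(v)` on a third space, up to factors `R₁₃` and `R₂₃`
(`fusedK_exchange`). At argument `q⁻¹` the `R`-matrix has rank one, with the singlet as image.
Multiplying by it turns T into a single element of the algebra (`singlet_mul_fusedK`) and the pairs
`R₁₃ R₂₃` into scalars (`singlet_mul`). What remains is that this element, the Sklyanin determinant,
commutes with every entry of `K(v)` (`commute_sklyaninDet`). The identity `smul_deltaValue` then
transfers this to Δ, and the entries of `K(v)` give back the currents (`commute_deltaValue`).

This argument needs currents evaluated at the actual points `u`, `uq` and `v`, whereas the relations
are formal identities in `U⁻¹` and `V⁻¹`. With denominators cleared these are identities of power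
series, where scalar series without constant term may be substituted (`substHom`). Substituting
independent variables handles the pairs (`u`, `v`) and (`uq`, `v`); substituting two series in one
variable handles (`u`, `uq`). All three sets of relations then hold over the field `Laurent₂ K`.
Finally, commutation with the currents in `v` gives commutation with each generator, because a
current expanded in `v` is triangular in its generators. -/

noncomputable section

namespace AqAlgebra

open Matrix

/-! ### Six-vertex R-matrix -/

section RMatrix

/-- The `R`-matrix of the six-vertex model in the symmetric gauge. -/
def rMat {F : Type*} [Field F] (q x : F) : Matrix (Fin 2 × Fin 2) (Fin 2 × Fin 2) F :=
  fun i j =>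
    if i = j then (if i.1 = i.2 then q * x - (q * x)⁻¹ else x - x⁻¹)
    else if i.1 = j.2 ∧ i.2 = j.1 then q - q⁻¹ else 0

variable {S : Type*} [Ring S]

/-- An operator on the first and second of three spaces. -/
def op₁₂ (M : Matrix (Fin 2 × Fin 2) (Fin 2 × Fin 2) S) :
    Matrix (Fin 2 × Fin 2 × Fin 2) (Fin 2 × Fin 2 × Fin 2) S :=
  fun i j => if i.2.2 = j.2.2 then M (i.1, i.2.1) (j.1, j.2.1) else 0

/-- An operator on the first and third of three spaces. -/
def op₁₃ (M : Matrix (Fin 2 × Fin 2) (Fin 2 × Fin 2) S) :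
    Matrix (Fin 2 × Fin 2 × Fin 2) (Fin 2 × Fin 2 × Fin 2) S :=
  fun i j => if i.2.1 = j.2.1 then M (i.1, i.2.2) (j.1, j.2.2) else 0

/-- An operator on the second and third of three spaces. -/
def op₂₃ (M : Matrix (Fin 2 × Fin 2) (Fin 2 × Fin 2) S) :
    Matrix (Fin 2 × Fin 2 × Fin 2) (Fin 2 × Fin 2 × Fin 2) S :=
  fun i j => if i.1 = j.1 then M (i.2.1, i.2.2) (j.2.1, j.2.2) else 0

/-- An operator on the first of two spaces. -/
def fstOp (K : Matrix (Fin 2) (Fin 2) S) : Matrix (Fin 2 × Fin 2) (Fin 2 × Fin 2) S :=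
  fun i j => if i.2 = j.2 then K i.1 j.1 else 0

/-- An operator on the second of two spaces. -/
def sndOp (K : Matrix (Fin 2) (Fin 2) S) : Matrix (Fin 2 × Fin 2) (Fin 2 × Fin 2) S :=
  fun i j => if i.1 = j.1 then K i.2 j.2 else 0

theorem op₁₂_mul (M N : Matrix (Fin 2 × Fin 2) (Fin 2 × Fin 2) S) :
    op₁₂ (M * N) = op₁₂ M * op₁₂ N := by
  ext ⟨a, b, c⟩ ⟨a', b', c'⟩
  simp [op₁₂, Matrix.mul_apply, Fintype.sum_prod_type]

theorem op₁₃_mul (M N : Matrix (Fin 2 × Fin 2) (Fin 2 × Fin 2) S) :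
    op₁₃ (M * N) = op₁₃ M * op₁₃ N := by
  ext ⟨a, b, c⟩ ⟨a', b', c'⟩
  simp [op₁₃, Matrix.mul_apply, Fintype.sum_prod_type]

theorem op₂₃_mul (M N : Matrix (Fin 2 × Fin 2) (Fin 2 × Fin 2) S) :
    op₂₃ (M * N) = op₂₃ M * op₂₃ N := by
  ext ⟨a, b, c⟩ ⟨a', b', c'⟩
  simp [op₂₃, Matrix.mul_apply, Fintype.sum_prod_type]

theorem op₁₃_fstOp (K : Matrix (Fin 2) (Fin 2) S) : op₁₃ (fstOp K) = op₁₂ (fstOp K) := by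
  ext ⟨a, b, c⟩ ⟨a', b', c'⟩
  simp only [op₁₂, op₁₃, fstOp]
  grind

theorem op₂₃_fstOp (K : Matrix (Fin 2) (Fin 2) S) : op₂₃ (fstOp K) = op₁₂ (sndOp K) := by
  ext ⟨a, b, c⟩ ⟨a', b', c'⟩
  simp only [op₁₂, op₂₃, fstOp, sndOp]
  grind

theorem op₂₃_sndOp (K : Matrix (Fin 2) (Fin 2) S) : op₂₃ (sndOp K) = op₁₃ (sndOp K) := by
  ext ⟨a, b, c⟩ ⟨a', b', c'⟩
  simp only [op₁₃, op₂₃, sndOp]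
  grind

/-- Extension of scalars for matrices. -/
abbrev scalarMat {F : Type*} [CommRing F] (B : Type*) [Ring B] [Algebra F B] {n : Type*}
    (M : Matrix n n F) : Matrix n n B := M.map (algebraMap F B)

variable {F B : Type*} [Field F] [Ring B] [Algebra F B]

theorem scalarMat_mul {n : Type*} [Fintype n] (M N : Matrix n n F) :
    scalarMat B (M * N) = scalarMat B M * scalarMat B N := Matrix.map_mul

theorem op₁₂_scalarMat (M : Matrix (Fin 2 × Fin 2) (Fin 2 × Fin 2) F) :
    op₁₂ (scalarMat B M) = scalarMat B (op₁₂ M) := by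
  ext i j; simp [op₁₂, apply_ite (algebraMap F B)]

theorem op₁₃_scalarMat (M : Matrix (Fin 2 × Fin 2) (Fin 2 × Fin 2) F) :
    op₁₃ (scalarMat B M) = scalarMat B (op₁₃ M) := by
  ext i j; simp [op₁₃, apply_ite (algebraMap F B)]

theorem op₂₃_scalarMat (M : Matrix (Fin 2 × Fin 2) (Fin 2 × Fin 2) F) :
    op₂₃ (scalarMat B M) = scalarMat B (op₂₃ M) := by
  ext i j; simp [op₂₃, apply_ite (algebraMap F B)]

/-- The two operators act on disjoint factors, and one of them has scalar, hence central, entries.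
No commutativity in `B` is involved. The same holds for the next two lemmas. -/
theorem commute_op₂₃_fst (M : Matrix (Fin 2 × Fin 2) (Fin 2 × Fin 2) F)
    (K : Matrix (Fin 2) (Fin 2) B) :
    Commute (op₂₃ (scalarMat B M)) (op₁₂ (fstOp K)) := by
  ext ⟨a, b, c⟩ ⟨a', b', c'⟩
  simp [op₂₃, op₁₂, fstOp, Matrix.mul_apply, Fintype.sum_prod_type, -Fin.sum_univ_two]
  exact Algebra.commutes _ _

theorem commute_op₁₃_snd (M : Matrix (Fin 2 × Fin 2) (Fin 2 × Fin 2) F)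
    (K : Matrix (Fin 2) (Fin 2) B) :
    Commute (op₁₃ (scalarMat B M)) (op₁₂ (sndOp K)) := by
  ext ⟨a, b, c⟩ ⟨a', b', c'⟩
  simp [op₁₃, op₁₂, sndOp, Matrix.mul_apply, Fintype.sum_prod_type, -Fin.sum_univ_two]
  exact Algebra.commutes _ _

theorem commute_op₁₂_third (M : Matrix (Fin 2 × Fin 2) (Fin 2 × Fin 2) F)
    (K : Matrix (Fin 2) (Fin 2) B) :
    Commute (op₁₂ (scalarMat B M)) (op₁₃ (sndOp K)) := by
  ext ⟨a, b, c⟩ ⟨a', b', c'⟩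
  simp [op₁₂, op₁₃, sndOp, Matrix.mul_apply, Fintype.sum_prod_type, -Fin.sum_univ_two]
  exact Algebra.commutes _ _

end RMatrix
end AqAlgebra
end

/-! ### Yang–Baxter equation and the singlet -/

noncomputable section
namespace AqAlgebra
open Matrix
section YangBaxter

variable {F : Type*} [Field F]

/-- The Kronecker deltas in the embedded operators leave only three internal indices, so each of the
64 entries in the checks below is a sum of eight terms. -/
theorem op_mul_apply₂₃₁₂₁₃ (X Y Z : Matrix (Fin 2 × Fin 2) (Fin 2 × Fin 2) F)
    (a b c a' b' c' : Fin 2) :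
    (op₂₃ X * op₁₂ Y * op₁₃ Z) (a, b, c) (a', b', c')
      = ∑ k, ∑ j, ∑ i, X (b, c) (i, j) * Y (a, i) (k, b') * Z (k, j) (a', c') := by
  simp [op₁₂, op₁₃, op₂₃, Matrix.mul_apply, Fintype.sum_prod_type, -Fin.sum_univ_two,
    Finset.sum_mul]

theorem op_mul_apply₁₃₁₂₂₃ (X Y Z : Matrix (Fin 2 × Fin 2) (Fin 2 × Fin 2) F)
    (a b c a' b' c' : Fin 2) :
    (op₁₃ X * op₁₂ Y * op₂₃ Z) (a, b, c) (a', b', c')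
      = ∑ k, ∑ j, ∑ i, X (a, c) (i, j) * Y (i, b) (a', k) * Z (k, j) (b', c') := by
  simp [op₁₂, op₁₃, op₂₃, Matrix.mul_apply, Fintype.sum_prod_type, -Fin.sum_univ_two,
    Finset.sum_mul]

theorem op_mul_apply₁₂₁₃₂₃ (X Y Z : Matrix (Fin 2 × Fin 2) (Fin 2 × Fin 2) F)
    (a b c a' b' c' : Fin 2) :
    (op₁₂ X * op₁₃ Y * op₂₃ Z) (a, b, c) (a', b', c')
      = ∑ k, ∑ j, ∑ i, X (a, b) (i, k) * Y (i, c) (a', j) * Z (k, j) (b', c') := by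
  simp [op₁₂, op₁₃, op₂₃, Matrix.mul_apply, Fintype.sum_prod_type, -Fin.sum_univ_two,
    Finset.sum_mul]

-- This is the usual equation with the spaces taken in the order 2, 3, 1: the `R`-matrix is
-- invariant under exchange of its two spaces, so `R₂₁ = R₁₂` and `R₃₁ = R₁₃`. It is checked entry
-- by entry.
set_option maxHeartbeats 4000000 in
theorem yangBaxter (q x z : F) (hq : q ≠ 0) (hx : x ≠ 0) (hz : z ≠ 0) :
    op₂₃ (rMat q x) * op₁₂ (rMat q (x * z)) * op₁₃ (rMat q z)
      = op₁₃ (rMat q z) * op₁₂ (rMat q (x * z)) * op₂₃ (rMat q x) := by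
  ext ⟨a, b, c⟩ ⟨a', b', c'⟩
  rw [op_mul_apply₂₃₁₂₁₃, op_mul_apply₁₃₁₂₂₃]
  fin_cases a <;> fin_cases b <;> fin_cases c <;> fin_cases a' <;> fin_cases b' <;>
    fin_cases c' <;>
    simp only [Fin.sum_univ_two, Fin.isValue, Fin.zero_eta, Fin.mk_one, rMat,
      Prod.mk.injEq, zero_ne_one, one_ne_zero, and_true, and_false, true_and, reduceIte, zero_mul,
      mul_zero, add_zero, zero_add] <;> field_simp <;> ring

set_option maxHeartbeats 4000000 in
/-- The singlet in the first two spaces is an eigenvector of a product of two `R`-matrices. -/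
theorem singlet_mul (q x : F) (hq : q ≠ 0) (hx : x ≠ 0) :
    op₁₂ (rMat q q⁻¹) * op₁₃ (rMat q x) * op₂₃ (rMat q (x * q))
      = ((q ^ 2 * x - (q ^ 2 * x)⁻¹) * (x - x⁻¹)) • op₁₂ (rMat q q⁻¹) := by
  ext ⟨a, b, c⟩ ⟨a', b', c'⟩
  rw [op_mul_apply₁₂₁₃₂₃]
  fin_cases a <;> fin_cases b <;> fin_cases c <;> fin_cases a' <;> fin_cases b' <;>
    fin_cases c' <;>
    simp only [Fin.sum_univ_two, Fin.isValue, Fin.zero_eta, Fin.mk_one, rMat,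
      Prod.mk.injEq, zero_ne_one, one_ne_zero, and_true, and_false, true_and, reduceIte, zero_mul,
      mul_zero, add_zero, zero_add, op₁₂, Matrix.smul_apply, smul_eq_mul,
      mul_inv_cancel₀ hq, inv_one, sub_self] <;> field_simp <;> ring

end YangBaxter
end AqAlgebra
end

/-! ### Fusion and the Sklyanin determinant -/

noncomputable section
namespace AqAlgebra
open Matrix
section SklyaninDeterminant

variable {F B : Type*} [Field F] [Ring B] [Algebra F B]

/-- The reflection equation for two `K`-matrices with spectral parameters `u`, `v`. -/
def ReflectionEq (q u v : F) (K L : Matrix (Fin 2) (Fin 2) B) : Prop :=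
  scalarMat B (rMat q (u * v⁻¹)) * (fstOp K * scalarMat B (rMat q (u * v)) * sndOp L)
    = sndOp L * scalarMat B (rMat q (u * v)) * fstOp K * scalarMat B (rMat q (u * v⁻¹))

/-- The product `K₁(u) R(q u²) K₂(q u)`. -/
def fusedK (q u : F) (K L : Matrix (Fin 2) (Fin 2) B) :
    Matrix (Fin 2 × Fin 2) (Fin 2 × Fin 2) B :=
  fstOp K * scalarMat B (rMat q (u * (u * q))) * sndOp L

/-- Spaces 1, 2, 3 carry the parameters `u`, `uq`, `v`. Each reflection equation moves `M` past one
factor of the fused matrix, and the Yang–Baxter equation reorders the `R`-matrices before and after.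
-/
theorem fusedK_exchange (q u v : F) (hq : q ≠ 0) (hu : u ≠ 0) (hv : v ≠ 0)
    (K L M : Matrix (Fin 2) (Fin 2) B)
    (hKM : ReflectionEq q u v K M) (hLM : ReflectionEq q (u * q) v L M) :
    op₁₃ (scalarMat B (rMat q (u * v⁻¹))) * op₂₃ (scalarMat B (rMat q (u * q * v⁻¹)))
        * op₁₂ (fusedK q u K L)
        * (op₁₃ (scalarMat B (rMat q (u * v))) * op₂₃ (scalarMat B (rMat q (u * q * v))))
        * op₁₃ (sndOp M)
      = op₁₃ (sndOp M)
        * (op₁₃ (scalarMat B (rMat q (u * v))) * op₂₃ (scalarMat B (rMat q (u * q * v))))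
        * op₁₂ (fusedK q u K L)
        * (op₁₃ (scalarMat B (rMat q (u * v⁻¹)))
          * op₂₃ (scalarMat B (rMat q (u * q * v⁻¹)))) := by
  have h1 := congrArg op₁₃ hKM
  have h2 := congrArg op₂₃ hLM
  simp only [op₁₃_mul, op₂₃_mul, op₁₃_fstOp, op₂₃_fstOp, op₂₃_sndOp] at h1 h2
  -- The arguments are chosen so that the middle factor is `R₁₂` at `u · uq` in both instances, the
  -- one inside `fusedK`.
  have y1 := congrArg (scalarMat B) (yangBaxter q (u * q * v⁻¹) (u * v) hq
    (by simp [*]) (by simp [*]))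
  have y2 := congrArg (scalarMat B) (yangBaxter q (u * q * v) (u * v⁻¹) hq
    (by simp [*]) (by simp [*]))
  rw [show u * q * v⁻¹ * (u * v) = u * (u * q) by field_simp] at y1
  rw [show u * q * v * (u * v⁻¹) = u * (u * q) by field_simp] at y2
  simp only [scalarMat_mul, ← op₁₂_scalarMat, ← op₁₃_scalarMat, ← op₂₃_scalarMat] at y1 y2
  simp only [fusedK, op₁₂_mul]
  have c1 := (commute_op₂₃_fst (rMat q (u * q * v⁻¹)) K).eq
  have c2 := (commute_op₁₃_snd (rMat q (u * v)) L).eq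
  have c3 := (commute_op₁₂_third (rMat q (u * (u * q))) M).eq
  have c4 := (commute_op₁₃_snd (rMat q (u * v⁻¹)) L).eq
  have c5 := (commute_op₂₃_fst (rMat q (u * q * v)) K).eq
  generalize op₁₃ (scalarMat B (rMat q (u * v⁻¹))) = Am at *
  generalize op₂₃ (scalarMat B (rMat q (u * q * v⁻¹))) = Bm at *
  generalize op₁₃ (scalarMat B (rMat q (u * v))) = Ap at *
  generalize op₂₃ (scalarMat B (rMat q (u * q * v))) = Bp at *
  generalize op₁₂ (scalarMat B (rMat q (u * (u * q)))) = R at *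
  generalize op₁₂ (fstOp K) = k at *
  generalize op₁₂ (sndOp L) = l at *
  generalize op₁₃ (sndOp M) = m at *
  calc Am * Bm * (k * R * l) * (Ap * Bp) * m
      = Am * (Bm * k) * R * (l * Ap) * Bp * m := by noncomm_ring
    _ = Am * k * (Bm * R * Ap) * l * Bp * m := by rw [c1, ← c2]; noncomm_ring
    _ = Am * k * Ap * R * (Bm * (l * Bp * m)) := by rw [y1]; noncomm_ring
    _ = Am * k * Ap * (R * m) * Bp * l * Bm := by rw [h2]; noncomm_ring
    _ = (Am * (k * Ap * m)) * R * Bp * l * Bm := by rw [c3]; noncomm_ring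
    _ = m * Ap * k * (Am * R * Bp) * l * Bm := by rw [h1]; noncomm_ring
    _ = m * Ap * (k * Bp) * R * (Am * l) * Bm := by rw [← y2]; noncomm_ring
    _ = m * (Ap * Bp) * (k * R * l) * (Am * Bm) := by rw [c4, ← c5]; noncomm_ring

/-- The Sklyanin determinant. -/
def sklyaninDet (q u : F) (K L : Matrix (Fin 2) (Fin 2) B) : B :=
  fusedK q u K L (0, 1) (0, 1) - fusedK q u K L (1, 0) (0, 1)

/-- The points `u` and `uq` have ratio `q⁻¹`, where the `R`-matrix P is a multiple of the
antisymmetriser. The reflection equation reads P T = X P, so both the rows and the columns of P T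
are multiples of the singlet. Hence P T is an element of `B` times P. -/
theorem singlet_mul_fusedK (q u : F) (hq : q ≠ 0) (hq2 : q - q⁻¹ ≠ 0) (hu : u ≠ 0)
    (K L : Matrix (Fin 2) (Fin 2) B) (h : ReflectionEq q u (u * q) K L) :
    scalarMat B (rMat q q⁻¹) * fusedK q u K L
      = sklyaninDet q u K L • scalarMat B (rMat q q⁻¹) := by
  rw [ReflectionEq, show u * (u * q)⁻¹ = q⁻¹ by field_simp] at h
  change scalarMat B (rMat q q⁻¹) * fusedK q u K L = _ at h
  generalize sndOp L * scalarMat B (rMat q (u * (u * q))) * fstOp K = X at h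
  rw [sklyaninDet]
  generalize fusedK q u K L = T at h ⊢
  have hc : IsUnit (algebraMap F B (q - q⁻¹)) := (IsUnit.mk0 _ hq2).map _
  -- The columns (0,0) and (1,1) of P vanish, and the columns (0,1) and (1,0) are opposite. Hence
  -- the right-hand sides vanish in `e0` and `e1` and cancel in the sum of `e2` and `e3`, which
  -- removes X.
  have e0 := congrFun (congrFun h (0, 1)) (0, 0)
  have e1 := congrFun (congrFun h (0, 1)) (1, 1)
  have e2 := congrFun (congrFun h (0, 1)) (0, 1)
  have e3 := congrFun (congrFun h (0, 1)) (1, 0)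
  have hc' : algebraMap F B (q⁻¹ - q) = - algebraMap F B (q - q⁻¹) := by
    rw [← map_neg, neg_sub]
  simp only [Matrix.mul_apply, Fintype.sum_prod_type, Fin.sum_univ_two, scalarMat,
    Matrix.map_apply] at e0 e1 e2 e3
  simp [rMat, hq, -map_sub, hc'] at e0 e1 e2 e3
  have hcomm : ∀ b : B, b * algebraMap F B (q - q⁻¹) = algebraMap F B (q - q⁻¹) * b :=
    fun b => (Algebra.commutes _ b).symm
  have f0 : T (1, 0) (0, 0) = T (0, 1) (0, 0) :=
    hc.mul_left_cancel (by rw [← sub_eq_zero, ← e0]; abel)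
  have f1 : T (1, 0) (1, 1) = T (0, 1) (1, 1) :=
    hc.mul_left_cancel (by rw [← sub_eq_zero, ← e1]; abel)
  have f2 : T (1, 0) (1, 0) = T (0, 1) (0, 1) - T (1, 0) (0, 1) + T (0, 1) (1, 0) := by
    apply hc.mul_left_cancel
    have := congrArg₂ (· + ·) e2 e3
    rw [← sub_eq_zero] at this ⊢
    rw [← this]
    simp only [mul_add, mul_sub]
    abel
  ext ⟨a, b⟩ ⟨c, d⟩
  simp only [Matrix.mul_apply, Fintype.sum_prod_type, Fin.sum_univ_two, scalarMat,
    Matrix.map_apply, Matrix.smul_apply, smul_eq_mul]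
  fin_cases a <;> fin_cases b <;> fin_cases c <;> fin_cases d <;>
    simp [rMat, hq, -map_sub, hc', f0, f1, f2, hcomm, mul_add, mul_sub] <;> abel

/-- The conditions `hm` and `hp` say that the two scalars produced by `singlet_mul`, at arguments `u
v⁻¹` and `u v`, can be cancelled. -/
theorem commute_sklyaninDet (q u v : F) (hq : q ≠ 0) (hq2 : q - q⁻¹ ≠ 0) (hu : u ≠ 0) (hv : v ≠ 0)
    (hm : (q ^ 2 * (u * v⁻¹) - (q ^ 2 * (u * v⁻¹))⁻¹) * ((u * v⁻¹) - (u * v⁻¹)⁻¹) ≠ 0)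
    (hp : (q ^ 2 * (u * v) - (q ^ 2 * (u * v))⁻¹) * ((u * v) - (u * v)⁻¹) ≠ 0)
    (K L M : Matrix (Fin 2) (Fin 2) B) (hKL : ReflectionEq q u (u * q) K L)
    (hKM : ReflectionEq q u v K M) (hLM : ReflectionEq q (u * q) v L M) (i j : Fin 2) :
    Commute (sklyaninDet q u K L) (M i j) := by
  have h := fusedK_exchange q u v hq hu hv K L M hKM hLM
  have s1 := congrArg (scalarMat B) (singlet_mul q (u * v⁻¹) hq (by simp [*]))
  have s2 := congrArg (scalarMat B) (singlet_mul q (u * v) hq (by simp [*]))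
  rw [show u * v⁻¹ * q = u * q * v⁻¹ by ring] at s1
  rw [show u * v * q = u * q * v by ring] at s2
  generalize (q ^ 2 * (u * v⁻¹) - (q ^ 2 * (u * v⁻¹))⁻¹) * ((u * v⁻¹) - (u * v⁻¹)⁻¹) = cm at *
  generalize (q ^ 2 * (u * v) - (q ^ 2 * (u * v))⁻¹) * ((u * v) - (u * v)⁻¹) = cp at *
  have hsm : ∀ (c : F) (N : Matrix (Fin 2 × Fin 2 × Fin 2) (Fin 2 × Fin 2 × Fin 2) F),
      scalarMat B (c • N) = c • scalarMat B N := by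
    intro c N; ext i j
    change algebraMap F B (c * N i j) = c • algebraMap F B (N i j)
    rw [map_mul, Algebra.smul_def]
  simp only [scalarMat_mul, hsm, ← op₁₂_scalarMat, ← op₁₃_scalarMat, ← op₂₃_scalarMat] at s1 s2
  have s3 := congrArg op₁₂ (singlet_mul_fusedK q u hq hq2 hu K L hKL)
  have c3 := (commute_op₁₂_third (rMat q q⁻¹) M).eq
  rw [op₁₂_mul] at s3
  have hop : op₁₂ (sklyaninDet q u K L • scalarMat B (rMat q q⁻¹))
      = sklyaninDet q u K L • op₁₂ (scalarMat B (rMat q q⁻¹)) := by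
    ext i j; simp [op₁₂]
  rw [hop] at s3
  generalize sklyaninDet q u K L = δ at *
  generalize op₁₂ (fusedK q u K L) = T at *
  generalize op₁₃ (scalarMat B (rMat q (u * v⁻¹))) = Am at *
  generalize op₂₃ (scalarMat B (rMat q (u * q * v⁻¹))) = Bm at *
  generalize op₁₃ (scalarMat B (rMat q (u * v))) = Ap at *
  generalize op₂₃ (scalarMat B (rMat q (u * q * v))) = Bp at *
  -- The exchange relation is multiplied on the left by P. On either side P passes through the
  -- `R`-pairs as the scalars `cm` and `cp`, through T as δ, and commutes with `M` in the third
  -- space.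
  have key : δ • (op₁₂ (scalarMat B (rMat q q⁻¹)) * op₁₃ (sndOp M))
      = op₁₃ (sndOp M) * (δ • op₁₂ (scalarMat B (rMat q q⁻¹))) := by
    generalize op₁₂ (scalarMat B (rMat q q⁻¹)) = P at *
    generalize op₁₃ (sndOp M) = m at *
    have hL : P * (Am * Bm * T * (Ap * Bp) * m) = cm • cp • δ • (P * m) := by
      calc P * (Am * Bm * T * (Ap * Bp) * m) = (P * Am * Bm) * (T * (Ap * Bp) * m) := by
            simp only [mul_assoc]
        _ = cm • ((P * T) * ((Ap * Bp) * m)) := by rw [s1]; simp only [mul_assoc, smul_mul_assoc]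
        _ = cm • δ • ((P * Ap * Bp) * m) := by rw [s3]; simp only [mul_assoc, smul_mul_assoc]
        _ = cm • cp • δ • (P * m) := by rw [s2, smul_mul_assoc, smul_comm δ cp]
    have hR : P * (m * (Ap * Bp) * T * (Am * Bm)) = cm • cp • (m * (δ • P)) := by
      calc P * (m * (Ap * Bp) * T * (Am * Bm)) = (P * m) * ((Ap * Bp) * T * (Am * Bm)) := by
            simp only [mul_assoc]
        _ = m * (P * Ap * Bp) * (T * (Am * Bm)) := by rw [c3]; simp only [mul_assoc]
        _ = cp • (m * (P * T * (Am * Bm))) := by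
            rw [s2]; simp only [mul_assoc, smul_mul_assoc, mul_smul_comm]
        _ = cp • (m * (δ • (P * Am * Bm))) := by rw [s3]; simp only [mul_assoc, smul_mul_assoc]
        _ = cm • cp • (m * (δ • P)) := by
            rw [s1, smul_comm δ cm, mul_smul_comm, smul_comm cm cp]
    have := hL.symm.trans ((congrArg (P * ·) h).trans hR)
    exact (smul_right_injective _ hp) ((smul_right_injective _ hm) this)
  -- The diagonal entry of P at (0,1) is the nonzero scalar `q⁻¹ - q`, so this block is a unit times
  -- the commutator of δ with `M i j`.
  have e := congrFun (congrFun key (0, 1, i)) (0, 1, j)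
  simp [op₁₂, op₁₃, sndOp, rMat, hq, Matrix.mul_apply, Fintype.sum_prod_type,
    -Fin.sum_univ_two] at e
  rw [← map_sub, ← Algebra.commutes, ← mul_assoc, ← Algebra.commutes, ← mul_assoc,
    ← Algebra.commutes _ (M i j), mul_assoc, mul_assoc, ← sub_eq_zero, ← mul_sub] at e
  have hc : IsUnit (algebraMap F B (q⁻¹ - q)) :=
    (IsUnit.mk0 _ (by rw [← neg_sub]; exact neg_ne_zero.mpr hq2)).map _
  exact sub_eq_zero.mp (hc.mul_right_eq_zero.mp e)

end SklyaninDeterminant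
end AqAlgebra
end

/-! ### From the current relations to the reflection equation -/

noncomputable section
namespace AqAlgebra
open Matrix
section Exchange

variable {F B : Type*} [Field F] [Ring B] [Algebra F B]

/-- The defining relations of `𝒜_q` for the values of the currents at two points. -/
structure ExchangeRel (q ρ U V : F) (W G w g : ℤˣ → B) : Prop where
  ww_same (ε : ℤˣ) : ⁅W ε, w ε⁆ = 0
  ww_mixed : ⁅W 1, w (-1)⁆ + ⁅W (-1), w 1⁆ = 0
  ww_comm (ε : ℤˣ) :
    (U - V) • ⁅W ε, w (-ε)⁆
      = ((q - q⁻¹) / (ρ * (q + q⁻¹))) • (G ε * g (-ε) - g ε * G (-ε))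
        + (1 / (q + q⁻¹)) • (G ε - G (-ε) + g (-ε) - g ε)
  ww_gg (ε : ℤˣ) :
    (U - V) • (W ε * w ε - W (-ε) * w (-ε)
        + (1 / (ρ * (q ^ 2 - (q⁻¹) ^ 2))) • ⁅G ε, g (-ε)⁆)
      + (1 - U * V) • (W ε * w (-ε) - w ε * W (-ε)) = 0
  gw_q (ε : ℤˣ) :
    U • qComm q (g (-ε)) (W ε) - V • qComm q (G (-ε)) (w ε)
      - (q - q⁻¹) • (W (-ε) * g (-ε) - w (-ε) * G (-ε))
      + ρ • (U • W ε - V • w ε - W (-ε) + w (-ε)) = 0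
  wg_q (ε : ℤˣ) :
    U • qComm q (W (-ε)) (g (-ε)) - V • qComm q (w (-ε)) (G (-ε))
      - (q - q⁻¹) • (W ε * g (-ε) - w ε * G (-ε))
      + ρ • (U • W (-ε) - V • w (-ε) - W ε + w ε) = 0
  gw_comm (η ε : ℤˣ) : ⁅G η, w ε⁆ + ⁅W ε, g η⁆ = 0
  gg_same (ε : ℤˣ) : ⁅G ε, g ε⁆ = 0
  gg_mixed : ⁅G 1, g (-1)⁆ + ⁅G (-1), g 1⁆ = 0

/-- `U = (q u² + q⁻¹ u⁻²) / (q + q⁻¹)`. -/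
def spectralValue (q u : F) : F := (q * u ^ 2 + q⁻¹ * u⁻¹ ^ 2) / (q + q⁻¹)

/-- The `K`-matrix made of the currents. -/
def kMat (q ρ u : F) (W G : ℤˣ → B) : Matrix (Fin 2) (Fin 2) B :=
  !![(q * u) • W 1 - (q⁻¹ * u⁻¹) • W (-1), G 1 + (ρ / (q - q⁻¹)) • 1;
    ρ⁻¹ • G (-1) + (1 / (q - q⁻¹)) • 1, (q * u) • W (-1) - (q⁻¹ * u⁻¹) • W 1]

theorem mul_fstOp_mul_sndOp_apply (R S : Matrix (Fin 2 × Fin 2) (Fin 2 × Fin 2) F)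
    (K L : Matrix (Fin 2) (Fin 2) B) (i j k l : Fin 2) :
    (scalarMat B R * (fstOp K * scalarMat B S * sndOp L)) (i, j) (k, l)
      = ∑ a, ∑ b, ∑ d, ∑ c, (R (i, j) (a, b) * S (c, b) (k, d)) • (K a c * L d l) := by
  simp [fstOp, sndOp, Matrix.mul_apply, Fintype.sum_prod_type, -Fin.sum_univ_two,
    Finset.sum_mul, Finset.mul_sum]
  refine Finset.sum_congr rfl fun a _ => Finset.sum_congr rfl fun b _ =>
    Finset.sum_congr rfl fun d _ => Finset.sum_congr rfl fun c _ => ?_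
  rw [Algebra.smul_def, map_mul, ← Algebra.commutes]
  simp only [mul_assoc]

theorem sndOp_mul_fstOp_mul_apply (R S : Matrix (Fin 2 × Fin 2) (Fin 2 × Fin 2) F)
    (K L : Matrix (Fin 2) (Fin 2) B) (i j k l : Fin 2) :
    (sndOp L * scalarMat B S * fstOp K * scalarMat B R) (i, j) (k, l)
      = ∑ a, ∑ b, ∑ c, ∑ d, (R (a, b) (k, l) * S (i, d) (c, b)) • (L j d * K c a) := by
  simp [fstOp, sndOp, Matrix.mul_apply, Fintype.sum_prod_type, -Fin.sum_univ_two,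
    Finset.sum_mul, Finset.mul_sum]
  refine Finset.sum_congr rfl fun a _ => Finset.sum_congr rfl fun b _ =>
    Finset.sum_congr rfl fun c _ => Finset.sum_congr rfl fun d _ => ?_
  rw [Algebra.smul_def, map_mul, ← Algebra.commutes, ← Algebra.commutes]
  simp only [mul_assoc]


-- The constants added to the off-diagonal entries of `kMat` produce the inhomogeneous terms of the
-- relations. The entries split by the number of off-diagonal factors: two entries reduce to
-- `gg_same`, eight to the relations mixing `W` and `G`, and the other six to the `WW` relations
-- together with `gg_mixed`.
set_option maxHeartbeats 8000000 in
theorem reflectionEq_of_exchangeRel (q ρ u v : F) (hq : q ≠ 0) (hqs : q + q⁻¹ ≠ 0)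
    (hqd : q - q⁻¹ ≠ 0) (hρ : ρ ≠ 0) (hu : u ≠ 0) (hv : v ≠ 0) (W G w g : ℤˣ → B)
    (H : ExchangeRel q ρ (spectralValue q u) (spectralValue q v) W G w g) :
    ReflectionEq q u v (kMat q ρ u W G) (kMat q ρ v w g) := by
  have ww₁ := H.ww_same 1
  have ww₂ := H.ww_same (-1)
  have wm := H.ww_mixed
  have gm := H.gg_mixed
  have wc := H.ww_comm 1
  have wg := H.ww_gg 1
  have gg₁ := H.gg_same 1
  have gg₂ := H.gg_same (-1)
  have gw₁₁ := H.gw_comm 1 1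
  have gw₁₂ := H.gw_comm 1 (-1)
  have gw₂₁ := H.gw_comm (-1) 1
  have gw₂₂ := H.gw_comm (-1) (-1)
  have b₁ := H.gw_q 1
  have b₂ := H.gw_q (-1)
  have c₁ := H.wg_q 1
  have c₂ := H.wg_q (-1)
  have hq2 : q ^ 2 + 1 ≠ 0 := by
    intro h; apply hqs; field_simp; rw [mul_zero]; exact h
  have hq2' : q ^ 2 - 1 ≠ 0 := by
    intro h; apply hqd; field_simp; rw [mul_zero]; exact h
  -- In factored form the denominator is visibly a product of nonzero quantities.
  rw [show q ^ 2 - q⁻¹ ^ 2 = (q + q⁻¹) * (q - q⁻¹) by ring] at wg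
  simp only [qComm, Ring.lie_def, neg_neg, spectralValue] at ww₁ ww₂ wm gm wc wg gg₁ gg₂ gw₁₁ gw₁₂ gw₂₁ gw₂₂ b₁ b₂ c₁ c₂
  ext ⟨i, j⟩ ⟨k, l⟩
  rw [mul_fstOp_mul_sndOp_apply, sndOp_mul_fstOp_mul_apply]
  fin_cases i <;> fin_cases j <;> fin_cases k <;> fin_cases l <;>
    simp only [Fin.sum_univ_two, Fin.isValue, Fin.zero_eta, Fin.mk_one, rMat, Prod.mk.injEq, zero_ne_one, one_ne_zero, and_true, and_false,
      true_and, false_and, reduceIte, zero_mul, mul_zero, zero_smul, add_zero, zero_add, kMat, Matrix.of_apply, Matrix.cons_val', Matrix.cons_val_zero, Matrix.cons_val_one, Matrix.cons_val_fin_one,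
      mul_add, add_mul, mul_sub, sub_mul, smul_mul_assoc, mul_smul_comm, mul_one, one_mul, smul_smul]
  -- Here and below, the coefficients solve the linear system obtained by comparing the
  -- noncommutative monomials in `W`, `G`, `w`, `g`; `match_scalars` reduces each comparison to a
  -- rational identity in the field.
  · linear_combination (norm := skip) (u⁻¹ * v - q ^ 2 * u * v⁻¹ - q ^ 2 * u * v ^ 3 + q ^ 4 * u ^ 3 * v) • ww₁
      + (q⁻¹ ^ 4 * u⁻¹ ^ 3 * v⁻¹ - q⁻¹ ^ 2 * u⁻¹ * v⁻¹ ^ 3 - q⁻¹ ^ 2 * u⁻¹ * v + u * v⁻¹) • ww₂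
      + (-q⁻¹ ^ 2 * u⁻¹ ^ 3 * v + u⁻¹ * v⁻¹ + u⁻¹ * v ^ 3 - q ^ 2 * u * v) • wm
      + (q⁻¹ ^ 2 * u⁻¹ * v + u⁻¹ * v - u * v⁻¹ - q ^ 2 * u * v⁻¹) • wc
    match_scalars <;> field_simp <;> ring
  · linear_combination (norm := skip) (-q⁻¹ ^ 3 * u⁻¹ + q⁻¹ * u⁻¹ - q * u * v⁻¹ ^ 2 - q * u * v ^ 2) • gw₁₁
      + (q⁻¹ * u⁻¹ * v⁻¹ ^ 2 + q⁻¹ * u⁻¹ * v ^ 2 - q * u + q ^ 3 * u) • gw₁₂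
      + (q⁻¹ ^ 2 * u⁻¹ + u⁻¹) • b₂
      + (u + q ^ 2 * u) • c₂
    match_scalars <;> field_simp <;> ring
  · linear_combination (norm := skip) (u⁻¹ ^ 2 * v + q⁻¹ ^ 2 * v⁻¹ - q ^ 2 * v⁻¹ + q ^ 2 * u ^ 2 * v) • gw₁₁
      + (-q⁻¹ ^ 2 * u⁻¹ ^ 2 * v⁻¹ + q⁻¹ ^ 2 * v - q ^ 2 * v - u ^ 2 * v⁻¹) • gw₁₂
      + (-q⁻¹ * v⁻¹ - q * v⁻¹) • b₂
      + (-q⁻¹ * v - q * v) • c₂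
    match_scalars <;> field_simp <;> ring
  · linear_combination (norm := skip) (q⁻¹ * u⁻¹ ^ 2 - q * v⁻¹ ^ 2 - q⁻¹ * v ^ 2 + q * u ^ 2) • gg₁
    match_scalars <;> field_simp <;> ring
  · linear_combination (norm := skip) (q⁻¹ * u⁻¹ * ρ⁻¹ - q * u⁻¹ * ρ⁻¹ - q * u * v⁻¹ ^ 2 * ρ⁻¹ - q * u * v ^ 2 * ρ⁻¹) • gw₂₁
      + (q⁻¹ * u⁻¹ * v⁻¹ ^ 2 * ρ⁻¹ + q⁻¹ * u⁻¹ * v ^ 2 * ρ⁻¹ + q⁻¹ * u * ρ⁻¹ - q * u * ρ⁻¹) • gw₂₂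
      + (-u * ρ⁻¹ - q ^ 2 * u * ρ⁻¹) • b₁
      + (-q⁻¹ ^ 2 * u⁻¹ * ρ⁻¹ - u⁻¹ * ρ⁻¹) • c₁
    match_scalars <;> field_simp <;> ring
  · linear_combination (norm := skip) (q⁻¹ ^ 4 * u⁻¹ * v⁻¹ - 2 * q⁻¹ ^ 2 * u⁻¹ * v⁻¹ + u * v⁻¹ ^ 3 + u * v - u ^ 3 * v⁻¹) • ww₁
      + (-u⁻¹ ^ 3 * v + u⁻¹ * v⁻¹ + u⁻¹ * v ^ 3 - 2 * q ^ 2 * u * v + q ^ 4 * u * v) • ww₂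
      + (q⁻¹ ^ 2 * u⁻¹ ^ 3 * v⁻¹ - q⁻¹ ^ 2 * u⁻¹ * v⁻¹ ^ 3 - q⁻¹ ^ 2 * u⁻¹ * v + 2 * u * v⁻¹ - q ^ 2 * u * v⁻¹) • wm
      + (q⁻¹ ^ 2 * u⁻¹ * v⁻¹ * ρ⁻¹ - u⁻¹ * v⁻¹ * ρ⁻¹ - u * v * ρ⁻¹ + q ^ 2 * u * v * ρ⁻¹) • gm
      + (-q⁻¹ ^ 2 * u⁻¹ * v⁻¹ - u⁻¹ * v⁻¹ + u * v + q ^ 2 * u * v) • wc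
    match_scalars <;> field_simp <;> ring
  · linear_combination (norm := skip) (q⁻¹ ^ 3 * u⁻¹ ^ 2 - q⁻¹ * u⁻¹ ^ 2 - q⁻¹ ^ 3 * v⁻¹ ^ 2 + q * v⁻¹ ^ 2 + q⁻¹ * u ^ 2 - q * u ^ 2) • ww₁
      + (-q⁻¹ * u⁻¹ ^ 2 + q * u⁻¹ ^ 2 + q⁻¹ * v ^ 2 - q ^ 3 * v ^ 2 - q * u ^ 2 + q ^ 3 * u ^ 2) • ww₂
      + (-q⁻¹ * u⁻¹ ^ 2 * v ^ 2 + q * u⁻¹ ^ 2 * v ^ 2 + q⁻¹ - q ^ 3 - q * u ^ 2 * v ^ 2 + q ^ 3 * u ^ 2 * v ^ 2) • wm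
      + (1 * ((q - q⁻¹) * (q + q⁻¹) ^ 2)) • wg
    match_scalars <;> field_simp <;> ring
  · linear_combination (norm := skip) (-q⁻¹ ^ 2 * u⁻¹ ^ 2 * v⁻¹ - u ^ 2 * v⁻¹) • gw₁₁
      + (u⁻¹ ^ 2 * v + q ^ 2 * u ^ 2 * v) • gw₁₂
      + (q⁻¹ * v + q * v) • b₂
      + (q⁻¹ * v⁻¹ + q * v⁻¹) • c₂
    match_scalars <;> field_simp <;> ring
  · linear_combination (norm := skip) (u⁻¹ ^ 2 * v * ρ⁻¹ + q ^ 2 * u ^ 2 * v * ρ⁻¹) • gw₂₁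
      + (-q⁻¹ ^ 2 * u⁻¹ ^ 2 * v⁻¹ * ρ⁻¹ - u ^ 2 * v⁻¹ * ρ⁻¹) • gw₂₂
      + (q⁻¹ * v * ρ⁻¹ + q * v * ρ⁻¹) • b₁
      + (q⁻¹ * v⁻¹ * ρ⁻¹ + q * v⁻¹ * ρ⁻¹) • c₁
    match_scalars <;> field_simp <;> ring
  · linear_combination (norm := skip) (-q⁻¹ * u⁻¹ ^ 2 + q * u⁻¹ ^ 2 + q⁻¹ * v ^ 2 - q ^ 3 * v ^ 2 - q * u ^ 2 + q ^ 3 * u ^ 2) • ww₁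
      + (q⁻¹ ^ 3 * u⁻¹ ^ 2 - q⁻¹ * u⁻¹ ^ 2 - q⁻¹ ^ 3 * v⁻¹ ^ 2 + q * v⁻¹ ^ 2 + q⁻¹ * u ^ 2 - q * u ^ 2) • ww₂
      + (q⁻¹ ^ 3 * u⁻¹ ^ 2 * v⁻¹ ^ 2 - q⁻¹ * u⁻¹ ^ 2 * v⁻¹ ^ 2 - q⁻¹ ^ 3 + q + q⁻¹ * u ^ 2 * v⁻¹ ^ 2 - q * u ^ 2 * v⁻¹ ^ 2) • wm
      + (q⁻¹ * u⁻¹ ^ 2 * ρ⁻¹ - q⁻¹ * v⁻¹ ^ 2 * ρ⁻¹ - q * v ^ 2 * ρ⁻¹ + q * u ^ 2 * ρ⁻¹) • gm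
      + (-1 * ((q - q⁻¹) * (q + q⁻¹) ^ 2)) • wg
    match_scalars <;> field_simp <;> ring
  · linear_combination (norm := skip) (-u⁻¹ ^ 3 * v + u⁻¹ * v⁻¹ + u⁻¹ * v ^ 3 - 2 * q ^ 2 * u * v + q ^ 4 * u * v) • ww₁
      + (q⁻¹ ^ 4 * u⁻¹ * v⁻¹ - 2 * q⁻¹ ^ 2 * u⁻¹ * v⁻¹ + u * v⁻¹ ^ 3 + u * v - u ^ 3 * v⁻¹) • ww₂
      + (-q⁻¹ ^ 2 * u⁻¹ * v + 2 * u⁻¹ * v - q ^ 2 * u * v⁻¹ - q ^ 2 * u * v ^ 3 + q ^ 2 * u ^ 3 * v) • wm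
      + (q⁻¹ ^ 2 * u⁻¹ * v⁻¹ + u⁻¹ * v⁻¹ - u * v - q ^ 2 * u * v) • wc
    match_scalars <;> field_simp <;> ring
  · linear_combination (norm := skip) (q⁻¹ * u⁻¹ * v⁻¹ ^ 2 + q⁻¹ * u⁻¹ * v ^ 2 + q⁻¹ * u - q * u) • gw₁₁
      + (q⁻¹ * u⁻¹ - q * u⁻¹ - q * u * v⁻¹ ^ 2 - q * u * v ^ 2) • gw₁₂
      + (-u - q ^ 2 * u) • b₂
      + (-q⁻¹ ^ 2 * u⁻¹ - u⁻¹) • c₂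
    match_scalars <;> field_simp <;> ring
  · linear_combination (norm := skip) (q⁻¹ * u⁻¹ ^ 2 * ρ⁻¹ ^ 2 - q * v⁻¹ ^ 2 * ρ⁻¹ ^ 2 - q⁻¹ * v ^ 2 * ρ⁻¹ ^ 2 + q * u ^ 2 * ρ⁻¹ ^ 2) • gg₂
    match_scalars <;> field_simp <;> ring
  · linear_combination (norm := skip) (-q⁻¹ ^ 2 * u⁻¹ ^ 2 * v⁻¹ * ρ⁻¹ + q⁻¹ ^ 2 * v * ρ⁻¹ - q ^ 2 * v * ρ⁻¹ - u ^ 2 * v⁻¹ * ρ⁻¹) • gw₂₁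
      + (u⁻¹ ^ 2 * v * ρ⁻¹ + q⁻¹ ^ 2 * v⁻¹ * ρ⁻¹ - q ^ 2 * v⁻¹ * ρ⁻¹ + q ^ 2 * u ^ 2 * v * ρ⁻¹) • gw₂₂
      + (-q⁻¹ * v⁻¹ * ρ⁻¹ - q * v⁻¹ * ρ⁻¹) • b₁
      + (-q⁻¹ * v * ρ⁻¹ - q * v * ρ⁻¹) • c₁
    match_scalars <;> field_simp <;> ring
  · linear_combination (norm := skip) (q⁻¹ * u⁻¹ * v⁻¹ ^ 2 * ρ⁻¹ + q⁻¹ * u⁻¹ * v ^ 2 * ρ⁻¹ - q * u * ρ⁻¹ + q ^ 3 * u * ρ⁻¹) • gw₂₁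
      + (-q⁻¹ ^ 3 * u⁻¹ * ρ⁻¹ + q⁻¹ * u⁻¹ * ρ⁻¹ - q * u * v⁻¹ ^ 2 * ρ⁻¹ - q * u * v ^ 2 * ρ⁻¹) • gw₂₂
      + (q⁻¹ ^ 2 * u⁻¹ * ρ⁻¹ + u⁻¹ * ρ⁻¹) • b₁
      + (u * ρ⁻¹ + q ^ 2 * u * ρ⁻¹) • c₁
    match_scalars <;> field_simp <;> ring
  · linear_combination (norm := skip) (q⁻¹ ^ 4 * u⁻¹ ^ 3 * v⁻¹ - q⁻¹ ^ 2 * u⁻¹ * v⁻¹ ^ 3 - q⁻¹ ^ 2 * u⁻¹ * v + u * v⁻¹) • ww₁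
      + (u⁻¹ * v - q ^ 2 * u * v⁻¹ - q ^ 2 * u * v ^ 3 + q ^ 4 * u ^ 3 * v) • ww₂
      + (-q⁻¹ ^ 2 * u⁻¹ * v⁻¹ + u * v⁻¹ ^ 3 + u * v - q ^ 2 * u ^ 3 * v⁻¹) • wm
      + (q⁻¹ ^ 2 * u⁻¹ * v * ρ⁻¹ - u⁻¹ * v * ρ⁻¹ - u * v⁻¹ * ρ⁻¹ + q ^ 2 * u * v⁻¹ * ρ⁻¹) • gm
      + (-q⁻¹ ^ 2 * u⁻¹ * v - u⁻¹ * v + u * v⁻¹ + q ^ 2 * u * v⁻¹) • wc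
    match_scalars <;> field_simp <;> ring

end Exchange
end AqAlgebra
end

/-! ### Δ as a Sklyanin determinant -/

noncomputable section
namespace AqAlgebra
open Matrix
section Centrality

variable {F B : Type*} [Field F] [Ring B] [Algebra F B]

/-- The value of `Δ(u)` in terms of the values `W`, `G` of the currents at `u` and `w`, `g` at
`q u`. -/
def deltaValue (q ρ u : F) (W G w g : ℤˣ → B) : B :=
  -(((q - q⁻¹) * (q ^ 2 + (q⁻¹) ^ 2)) • (W 1 * w 1 + W (-1) * w (-1)))
  - ((q - q⁻¹) / ρ) • (G 1 * g (-1) + G (-1) * g 1)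
  + (q - q⁻¹) • (((u * q) ^ 2 + (u * q)⁻¹ ^ 2) • (W 1 * w (-1) + W (-1) * w 1))
  - G 1 - g 1 - G (-1) - g (-1)

theorem fusedK_apply (q u : F) (K L : Matrix (Fin 2) (Fin 2) B) (i j k l : Fin 2) :
    fusedK q u K L (i, j) (k, l)
      = ∑ d, ∑ c, rMat q (u * (u * q)) (c, j) (k, d) • (K i c * L d l) := by
  simp [fusedK, fstOp, sndOp, Matrix.mul_apply, Fintype.sum_prod_type, -Fin.sum_univ_two,
    Finset.sum_mul]
  refine Finset.sum_congr rfl fun d _ => Finset.sum_congr rfl fun c _ => ?_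
  rw [Algebra.smul_def, ← Algebra.commutes, mul_assoc]

/-- The identity P T = δ P, read in the columns (0,1) and (1,0), gives two expressions for δ. Their
sum treats the signs ± alike, as Δ does. Nothing is divided by 2, so the characteristic is
arbitrary. -/
theorem two_smul_sklyaninDet (q u : F) (hq : q ≠ 0) (hqd : q - q⁻¹ ≠ 0) (hu : u ≠ 0)
    (K L : Matrix (Fin 2) (Fin 2) B) (h : ReflectionEq q u (u * q) K L) :
    (2 : F) • sklyaninDet q u K L
      = fusedK q u K L (0, 1) (0, 1) - fusedK q u K L (1, 0) (0, 1)
        - fusedK q u K L (0, 1) (1, 0) + fusedK q u K L (1, 0) (1, 0) := by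
  have e := congrFun (congrFun (singlet_mul_fusedK q u hq hqd hu K L h) (0, 1)) (1, 0)
  have hc' : algebraMap F B (q⁻¹ - q) = - algebraMap F B (q - q⁻¹) := by
    rw [← map_neg, neg_sub]
  simp only [Matrix.mul_apply, Fintype.sum_prod_type, Fin.sum_univ_two, scalarMat,
    Matrix.map_apply, Matrix.smul_apply, smul_eq_mul] at e
  simp [rMat, hq, -map_sub, hc'] at e
  have hc : IsUnit (algebraMap F B (q - q⁻¹)) := (IsUnit.mk0 _ hqd).map _
  have e' : fusedK q u K L (1, 0) (1, 0) - fusedK q u K L (0, 1) (1, 0)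
      = sklyaninDet q u K L := by
    apply hc.mul_left_cancel
    rw [Algebra.commutes _ (sklyaninDet q u K L), ← e, mul_sub]
    abel
  rw [two_smul]
  nth_rewrite 2 [← e']
  rw [sklyaninDet]
  abel

/-- The factor on the left is the entry `q x - (q x)⁻¹` of the `R`-matrix at `x = q u²`, which
multiplies the products of off-diagonal entries of the `K`-matrices. The constants in those entries
yield the terms of Δ linear in the `G` and the multiple of 1. -/
theorem smul_deltaValue (q ρ u : F) (hq : q ≠ 0) (hqd : q - q⁻¹ ≠ 0) (hρ : ρ ≠ 0) (hu : u ≠ 0)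
    (W G w g : ℤˣ → B)
    (h : ReflectionEq q u (u * q) (kMat q ρ u W G) (kMat q ρ (u * q) w g)) :
    (q ^ 2 * u ^ 2 - (q ^ 2 * u ^ 2)⁻¹) • deltaValue q ρ u W G w g
      = (2 * (q - q⁻¹)) • sklyaninDet q u (kMat q ρ u W G) (kMat q ρ (u * q) w g)
        + ((q ^ 2 * u ^ 2 - (q ^ 2 * u ^ 2)⁻¹) * (2 * ρ / (q - q⁻¹))) • 1 := by
  rw [mul_comm 2, mul_smul, two_smul_sklyaninDet q u hq hqd hu _ _ h]
  have hq2' : q ^ 2 - 1 ≠ 0 := by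
    intro h; apply hqd; field_simp; rw [mul_zero]; exact h
  simp only [fusedK_apply, deltaValue, Fin.sum_univ_two, Fin.isValue, rMat, Prod.mk.injEq,
    zero_ne_one, one_ne_zero, and_true, and_false, true_and, reduceIte, zero_smul,
    add_zero, zero_add, kMat, Matrix.of_apply, Matrix.cons_val', Matrix.cons_val_zero,
    Matrix.cons_val_one, Matrix.cons_val_fin_one, mul_add, add_mul, mul_sub, sub_mul,
    smul_mul_assoc, mul_smul_comm, mul_one, one_mul]
  match_scalars <;> field_simp <;> ring

theorem commute_deltaValue (q ρ u v : F) (hq : q ≠ 0) (hqs : q + q⁻¹ ≠ 0)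
    (hqd : q - q⁻¹ ≠ 0) (hρ : ρ ≠ 0) (hu : u ≠ 0) (hv : v ≠ 0)
    (hqu : q ^ 2 * u ^ 2 - (q ^ 2 * u ^ 2)⁻¹ ≠ 0)
    (hqv : q ^ 2 * v ^ 2 - (q ^ 2 * v ^ 2)⁻¹ ≠ 0)
    (hm : (q ^ 2 * (u * v⁻¹) - (q ^ 2 * (u * v⁻¹))⁻¹) * ((u * v⁻¹) - (u * v⁻¹)⁻¹) ≠ 0)
    (hp : (q ^ 2 * (u * v) - (q ^ 2 * (u * v))⁻¹) * ((u * v) - (u * v)⁻¹) ≠ 0)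
    (W G w g W' G' : ℤˣ → B)
    (h₁₂ : ExchangeRel q ρ (spectralValue q u) (spectralValue q (u * q)) W G w g)
    (h₁₃ : ExchangeRel q ρ (spectralValue q u) (spectralValue q v) W G W' G')
    (h₂₃ : ExchangeRel q ρ (spectralValue q (u * q)) (spectralValue q v) w g W' G') (ε : ℤˣ) :
    Commute (deltaValue q ρ u W G w g) (W' ε) ∧ Commute (deltaValue q ρ u W G w g) (G' ε) := by
  have huq : u * q ≠ 0 := mul_ne_zero hu hq
  have r₁₂ := reflectionEq_of_exchangeRel q ρ u (u * q) hq hqs hqd hρ hu huq _ _ _ _ h₁₂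
  have r₁₃ := reflectionEq_of_exchangeRel q ρ u v hq hqs hqd hρ hu hv _ _ _ _ h₁₃
  have r₂₃ := reflectionEq_of_exchangeRel q ρ (u * q) v hq hqs hqd hρ huq hv _ _ _ _ h₂₃
  have hdet := commute_sklyaninDet q u v hq hqd hu hv hm hp _ _ _ r₁₂ r₁₃ r₂₃
  have hΔ := smul_deltaValue q ρ u hq hqd hρ hu _ _ _ _ r₁₂
  have smul_cancel : ∀ {c : F} {x y : B}, c ≠ 0 → Commute x (c • y) → Commute x y := by
    intro c x y hc h
    have := h.smul_right c⁻¹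
    rwa [inv_smul_smul₀ hc] at this
  have hM : ∀ i j, Commute (deltaValue q ρ u W G w g) (kMat q ρ v W' G' i j) := by
    intro i j
    refine (smul_cancel hqu ?_).symm
    rw [hΔ]
    exact ((hdet i j).symm.smul_right _).add_right ((Commute.one_right _).smul_right _)
  generalize deltaValue q ρ u W G w g = δ at hM
  have m00 := hM 0 0
  have m01 := hM 0 1
  have m10 := hM 1 0
  have m11 := hM 1 1
  simp only [kMat, Matrix.of_apply, Matrix.cons_val', Matrix.cons_val_zero,
    Matrix.cons_val_one, Matrix.cons_val_fin_one] at m00 m01 m10 m11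
  -- The diagonal entries of `K(v)` are a 2×2 linear system in the two `W`-currents, with
  -- determinant `q² v² - (q² v²)⁻¹`.
  have hW : ∀ x y : B, Commute δ ((q * v) • x - (q⁻¹ * v⁻¹) • y) →
      Commute δ ((q * v) • y - (q⁻¹ * v⁻¹) • x) → Commute δ x := by
    intro x y h1 h2
    apply smul_cancel hqv
    have := (h1.smul_right (q * v)).add_right (h2.smul_right (q⁻¹ * v⁻¹))
    convert this using 1
    match_scalars <;> field_simp <;> ring
  have hG1 : Commute δ (G' 1) := by
    have := m01.sub_right ((Commute.one_right δ).smul_right (ρ / (q - q⁻¹)))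
    rwa [add_sub_cancel_right] at this
  have hG2 : Commute δ (G' (-1)) := by
    have := m10.sub_right ((Commute.one_right δ).smul_right (1 / (q - q⁻¹)))
    rw [add_sub_cancel_right] at this
    exact smul_cancel (inv_ne_zero hρ) this
  rcases Int.units_eq_one_or ε with rfl | rfl
  · exact ⟨hW _ _ m00 m11, hG1⟩
  · exact ⟨hW _ _ m11 m00, hG2⟩

end Centrality
end AqAlgebra
end

/-! ### Substitution into power series with noncommuting coefficients -/

noncomputable section
namespace AqAlgebra
section Substitution
open PowerSeries

variable {R S A B : Type*} [Ring R] [Ring S] [Ring A] [Ring B]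

theorem coeff_mul_pow_eq_zero (a T : A⟦X⟧) (hT : constantCoeff T = 0) {d n : ℕ} (h : d < n) :
    coeff d (a * T ^ n) = 0 := by
  apply coeff_of_lt_order
  have h1 : (n : ℕ∞) ≤ (T ^ n).order := by
    have : (1 : ℕ∞) ≤ T.order := by
      rw [one_le_order_iff_constCoeff_eq_zero]; exact hT
    calc (n : ℕ∞) = n • 1 := by simp
      _ ≤ n • T.order := nsmul_le_nsmul_right this n
      _ ≤ _ := le_order_pow T n
  calc (d : ℕ∞) < n := by exact_mod_cast h
    _ ≤ (T ^ n).order := h1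
    _ ≤ a.order + (T ^ n).order := le_add_self
    _ ≤ _ := le_order_mul a (T ^ n)

/-- The substitution `∑ r_n Y^n ↦ ∑ φ(r_n) T^n`, for `T` without constant term. -/
def substFun (φ : R →+* A⟦X⟧) (T : A⟦X⟧) (f : R⟦X⟧) : A⟦X⟧ :=
  PowerSeries.mk fun d => coeff d (∑ n ∈ Finset.range (d + 1), φ (coeff n f) * T ^ n)

/-- Since `T ^ n` has order at least `n`, any truncation beyond degree `d` gives the same
coefficient. This freedom is what makes multiplicativity provable. -/
theorem coeff_substFun (φ : R →+* A⟦X⟧) (T : A⟦X⟧) (hT : constantCoeff T = 0) (f : R⟦X⟧)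
    {d N : ℕ} (h : d < N) :
    coeff d (substFun φ T f) = coeff d (∑ n ∈ Finset.range N, φ (coeff n f) * T ^ n) := by
  rw [substFun, coeff_mk, map_sum, map_sum]
  refine Finset.sum_subset (Finset.range_mono h) fun n _ hn => ?_
  exact coeff_mul_pow_eq_zero _ _ hT (by simpa using hn)

/-- `substFun` as a ring homomorphism, for `T` commuting with the image of `φ`. -/
def substHom (φ : R →+* A⟦X⟧) (T : A⟦X⟧) (hT : constantCoeff T = 0)
    (hc : ∀ r, Commute (φ r) T) : R⟦X⟧ →+* A⟦X⟧ where
  toFun := substFun φ T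
  map_zero' := by ext d; simp [substFun]
  map_one' := by
    ext d
    rw [coeff_substFun φ T hT _ (Nat.lt_succ_self d), Finset.sum_range_succ',
      Finset.sum_eq_zero]
    · simp
    · intro n _
      simp [coeff_one]
  map_add' f g := by
    ext d
    simp [substFun, add_mul, Finset.sum_add_distrib]
  map_mul' f g := by
    ext d
    have hmul : coeff d (substFun φ T f * substFun φ T g)
        = coeff d ((∑ n ∈ Finset.range (d + 1), φ (coeff n f) * T ^ n)
          * (∑ n ∈ Finset.range (d + 1), φ (coeff n g) * T ^ n)) := by
      rw [coeff_mul, coeff_mul]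
      refine Finset.sum_congr rfl fun p hp => ?_
      have := Finset.HasAntidiagonal.mem_antidiagonal.mp hp
      rw [coeff_substFun φ T hT f (N := d + 1) (by omega),
        coeff_substFun φ T hT g (N := d + 1) (by omega)]
    rw [hmul, coeff_substFun φ T hT _ (Nat.lt_succ_self d), Finset.sum_mul_sum]
    have hterm : ∀ m n, φ (coeff m f) * T ^ m * (φ (coeff n g) * T ^ n)
        = φ (coeff m f * coeff n g) * T ^ (m + n) := by
      intro m n
      rw [map_mul, pow_add, mul_assoc, mul_assoc, ← mul_assoc (T ^ m),
        ← ((hc _).pow_right m).eq, mul_assoc]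
    simp only [hterm]
    rw [← Finset.sum_product', map_sum, map_sum]
    have hl : ∀ k ∈ Finset.range (d + 1), coeff d (φ (coeff k (f * g)) * T ^ k)
        = ∑ p ∈ Finset.HasAntidiagonal.antidiagonal k,
          coeff d (φ (coeff p.1 f * coeff p.2 g) * T ^ (p.1 + p.2)) := by
      intro k _
      rw [coeff_mul k f g, map_sum, Finset.sum_mul, map_sum]
      refine Finset.sum_congr rfl fun p hp => ?_
      rw [Finset.HasAntidiagonal.mem_antidiagonal.mp hp]
    rw [Finset.sum_congr rfl hl, Finset.sum_sigma']
    -- The antidiagonals fill the triangle `m + n ≤ d` of the square of index pairs; the remaining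
    -- pairs carry `T ^ (m + n)` with `m + n > d` and contribute nothing in degree `d`.
    refine Finset.sum_of_injOn (fun p => p.2) ?_ ?_ ?_ ?_
    · rintro ⟨k, p⟩ h ⟨k', p'⟩ h' e
      simp only [Finset.coe_sigma, Set.mem_sigma_iff, Finset.mem_coe,
        Finset.HasAntidiagonal.mem_antidiagonal] at h h' e
      obtain ⟨-, rfl⟩ := h
      obtain ⟨-, rfl⟩ := h'
      subst e
      rfl
    · rintro ⟨k, p⟩ h
      simp only [Finset.coe_sigma, Set.mem_sigma_iff, Finset.mem_coe,
        Finset.HasAntidiagonal.mem_antidiagonal, Finset.mem_range] at h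
      simp only [Finset.coe_product, Set.mem_prod, Finset.mem_coe, Finset.mem_range]
      omega
    · rintro ⟨m, n⟩ h hn
      apply coeff_mul_pow_eq_zero _ _ hT
      by_contra hlt
      refine hn ⟨⟨m + n, (m, n)⟩, ?_, rfl⟩
      simp
      omega
    · rintro ⟨k, p⟩ h
      rfl

theorem substHom_C (φ : R →+* A⟦X⟧) (T : A⟦X⟧) (hT : constantCoeff T = 0)
    (hc : ∀ r, Commute (φ r) T) (r : R) : substHom φ T hT hc (C r) = φ r := by
  ext d
  change coeff d (substFun φ T (C r)) = _
  rw [coeff_substFun φ T hT _ (Nat.lt_succ_self d), Finset.sum_range_succ',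
    Finset.sum_eq_zero]
  · simp
  · intro n _
    simp

theorem substHom_X (φ : R →+* A⟦X⟧) (T : A⟦X⟧) (hT : constantCoeff T = 0)
    (hc : ∀ r, Commute (φ r) T) : substHom φ T hT hc X = T := by
  ext d
  change coeff d (substFun φ T X) = _
  rw [coeff_substFun φ T hT _ (show d < d + 2 by omega),
    Finset.sum_eq_single 1]
  · simp
  · intro n _ hn
    simp [coeff_X, hn]
  · simp

theorem substHom_map (φ : R →+* A⟦X⟧) (T : A⟦X⟧) (hT : constantCoeff T = 0)
    (hc : ∀ r, Commute (φ r) T) (h : S →+* R) (f : S⟦X⟧) :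
    substHom φ T hT hc (PowerSeries.map h f) = substHom (φ.comp h) T hT (fun s => hc (h s)) f := by
  ext d
  change coeff d (substFun _ T _) = coeff d (substFun _ T _)
  simp [substFun]

theorem map_substHom (φ : R →+* A⟦X⟧) (T : A⟦X⟧) (hT : constantCoeff T = 0)
    (hc : ∀ r, Commute (φ r) T) (g : A →+* B) (f : R⟦X⟧) :
    PowerSeries.map g (substHom φ T hT hc f)
      = substHom ((PowerSeries.map g).comp φ) (PowerSeries.map g T)
          (by rw [← coeff_zero_eq_constantCoeff_apply, coeff_map,
            coeff_zero_eq_constantCoeff_apply, hT, map_zero])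
          (fun r => (hc r).map (PowerSeries.map g)) f := by
  ext d
  change coeff d (PowerSeries.map g (substFun _ T _)) = coeff d (substFun _ _ _)
  simp only [substFun, coeff_map, coeff_mk, RingHom.comp_apply, ← map_pow, ← map_mul]
  rw [← map_sum (PowerSeries.map g), coeff_map]

end Substitution
end AqAlgebra
end

/-! ### Denominator-free relations and their transport -/

noncomputable section
namespace AqAlgebra
section Relations

/-- The defining relations of `𝒜_q` in terms of `x = U⁻¹`, `y = V⁻¹`, with denominators cleared;
scalars act through `κ`. -/
structure PolyRel {K P : Type*} [Field K] [Ring P] (q ρ : K) (κ : K →+* P) (x y : P)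
    (W G w g : ℤˣ → P) : Prop where
  ww_same (ε : ℤˣ) : W ε * w ε - w ε * W ε = 0
  ww_mixed : W 1 * w (-1) - w (-1) * W 1 + (W (-1) * w 1 - w 1 * W (-1)) = 0
  ww_comm (ε : ℤˣ) :
    (y - x) * (W ε * w (-ε) - w (-ε) * W ε)
      = x * y * (κ ((q - q⁻¹) / (ρ * (q + q⁻¹))) * (G ε * g (-ε) - g ε * G (-ε))
        + κ (1 / (q + q⁻¹)) * (G ε - G (-ε) + g (-ε) - g ε))
  ww_gg (ε : ℤˣ) :
    (y - x) * (W ε * w ε - W (-ε) * w (-ε)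
        + κ (1 / (ρ * (q ^ 2 - (q⁻¹) ^ 2))) * (G ε * g (-ε) - g (-ε) * G ε))
      + (x * y - 1) * (W ε * w (-ε) - w ε * W (-ε)) = 0
  gw_q (ε : ℤˣ) :
    y * (κ q * (g (-ε) * W ε) - κ q⁻¹ * (W ε * g (-ε)))
      - x * (κ q * (G (-ε) * w ε) - κ q⁻¹ * (w ε * G (-ε)))
      - x * y * κ (q - q⁻¹) * (W (-ε) * g (-ε) - w (-ε) * G (-ε))
      + κ ρ * (y * W ε - x * w ε - x * y * (W (-ε) - w (-ε))) = 0
  wg_q (ε : ℤˣ) :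
    y * (κ q * (W (-ε) * g (-ε)) - κ q⁻¹ * (g (-ε) * W (-ε)))
      - x * (κ q * (w (-ε) * G (-ε)) - κ q⁻¹ * (G (-ε) * w (-ε)))
      - x * y * κ (q - q⁻¹) * (W ε * g (-ε) - w ε * G (-ε))
      + κ ρ * (y * W (-ε) - x * w (-ε) - x * y * (W ε - w ε)) = 0
  gw_comm (η ε : ℤˣ) : G η * w ε - w ε * G η + (W ε * g η - g η * W ε) = 0
  gg_same (ε : ℤˣ) : G ε * g ε - g ε * G ε = 0
  gg_mixed : G 1 * g (-1) - g (-1) * G 1 + (G (-1) * g 1 - g 1 * G (-1)) = 0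

section Transport

variable {K P Q : Type*} [Field K] [Ring P] [Ring Q] {q ρ : K} {κ : K →+* P} {x y : P}
  {W G w g : ℤˣ → P}

theorem PolyRel.map (H : PolyRel q ρ κ x y W G w g) (f : P →+* Q) :
    PolyRel q ρ (f.comp κ) (f x) (f y) (fun ε => f (W ε)) (fun ε => f (G ε)) (fun ε => f (w ε))
      (fun ε => f (g ε)) := by
  constructor
  · intro ε; simpa only [map_mul, map_sub, map_add, map_zero, map_one, RingHom.comp_apply] using congrArg f (H.ww_same ε)
  · simpa only [map_mul, map_sub, map_add, map_zero, map_one, RingHom.comp_apply] using congrArg f H.ww_mixed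
  · intro ε; have := congrArg f (H.ww_comm ε)
    simp only [map_mul f, map_sub f, map_add f, map_zero f, map_one f] at this; exact this
  · intro ε; have := congrArg f (H.ww_gg ε)
    simp only [map_mul f, map_sub f, map_add f, map_zero f, map_one f] at this; exact this
  · intro ε; have := congrArg f (H.gw_q ε)
    simp only [map_mul f, map_sub f, map_add f, map_zero f, map_one f] at this; exact this
  · intro ε; have := congrArg f (H.wg_q ε)
    simp only [map_mul f, map_sub f, map_add f, map_zero f, map_one f] at this; exact this
  · intro η ε; simpa only [map_mul, map_sub, map_add, map_zero, map_one, RingHom.comp_apply] using congrArg f (H.gw_comm η ε)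
  · intro ε; simpa only [map_mul, map_sub, map_add, map_zero, map_one, RingHom.comp_apply] using congrArg f (H.gg_same ε)
  · simpa only [map_mul, map_sub, map_add, map_zero, map_one, RingHom.comp_apply] using congrArg f H.gg_mixed

/-- This descends the relations from Laurent series to the subring of power series, on which
substitution is defined. -/
theorem PolyRel.of_map (f : P →+* Q) (hf : Function.Injective f)
    (H : PolyRel q ρ (f.comp κ) (f x) (f y) (fun ε => f (W ε)) (fun ε => f (G ε))
      (fun ε => f (w ε)) (fun ε => f (g ε))) :
    PolyRel q ρ κ x y W G w g := by
  constructor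
  · intro ε; apply hf; simpa only [map_mul, map_sub, map_add, map_zero] using H.ww_same ε
  · apply hf; simpa only [map_mul, map_sub, map_add, map_zero] using H.ww_mixed
  · intro ε; apply hf
    simp only [map_mul f, map_sub f, map_add f, map_zero f, map_one f]; exact H.ww_comm ε
  · intro ε; apply hf
    simp only [map_mul f, map_sub f, map_add f, map_zero f, map_one f]; exact H.ww_gg ε
  · intro ε; apply hf
    simp only [map_mul f, map_sub f, map_add f, map_zero f, map_one f]; exact H.gw_q ε
  · intro ε; apply hf
    simp only [map_mul f, map_sub f, map_add f, map_zero f, map_one f]; exact H.wg_q ε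
  · intro η ε; apply hf
    simpa only [map_mul, map_sub, map_add, map_zero] using H.gw_comm η ε
  · intro ε; apply hf; simpa only [map_mul, map_sub, map_add, map_zero] using H.gg_same ε
  · apply hf; simpa only [map_mul, map_sub, map_add, map_zero] using H.gg_mixed

/-- The two forms of the relations differ by the invertible central factor `U⁻¹ V⁻¹`, which is
cancelled here and multiplied in again for the converse `ExchangeRel.polyRel`. -/
theorem PolyRel.exchangeRel {F B : Type*} [Field F] [Ring B] [Algebra F B] (j : K →+* F)
    {W G w g : ℤˣ → B} (U V : F) (hU : U ≠ 0) (hV : V ≠ 0)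
    (H : PolyRel q ρ ((algebraMap F B).comp j) (algebraMap F B U⁻¹) (algebraMap F B V⁻¹) W G w g) :
    ExchangeRel (j q) (j ρ) U V W G w g := by
  have cancel : ∀ {c : F}, c ≠ 0 → ∀ {b b' : B}, c • b = c • b' → b = b' := fun hc _ _ h =>
    smul_right_injective _ hc h
  have hUV : U⁻¹ * V⁻¹ ≠ 0 := mul_ne_zero (inv_ne_zero hU) (inv_ne_zero hV)
  constructor
  · intro ε; exact H.ww_same ε
  · exact H.ww_mixed
  · intro ε
    apply cancel hUV
    have h := H.ww_comm ε
    simp only [RingHom.comp_apply, ← map_sub, ← map_mul, ← Algebra.smul_def] at h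
    rw [Ring.lie_def, smul_smul]
    convert h using 2
    · field_simp
    · simp
  · intro ε
    apply cancel hUV
    have h := H.ww_gg ε
    simp only [RingHom.comp_apply, ← map_sub, ← map_mul, ← map_one (algebraMap F B), ← Algebra.smul_def] at h
    rw [Ring.lie_def, smul_add, smul_smul, smul_smul, smul_zero]
    convert h using 3
    · field_simp
    · simp
    · field_simp
  · intro ε
    apply cancel hUV
    have h := H.gw_q ε
    simp only [RingHom.comp_apply, mul_assoc, ← Algebra.smul_def, smul_mul_assoc] at h
    rw [smul_zero, ← h]
    simp only [qComm, map_sub, map_inv₀]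
    match_scalars <;> field_simp
  · intro ε
    apply cancel hUV
    have h := H.wg_q ε
    simp only [RingHom.comp_apply, mul_assoc, ← Algebra.smul_def, smul_mul_assoc] at h
    rw [smul_zero, ← h]
    simp only [qComm, map_sub, map_inv₀]
    match_scalars <;> field_simp
  · exact H.gw_comm
  · exact H.gg_same
  · exact H.gg_mixed

theorem ExchangeRel.polyRel {F B : Type*} [Field F] [Ring B] [Algebra F B] (j : K →+* F)
    {W G w g : ℤˣ → B} (U V : F) (hU : U ≠ 0) (hV : V ≠ 0)
    (H : ExchangeRel (j q) (j ρ) U V W G w g) :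
    PolyRel q ρ ((algebraMap F B).comp j) (algebraMap F B U⁻¹) (algebraMap F B V⁻¹) W G w g := by
  constructor
  · exact H.ww_same
  · exact H.ww_mixed
  · intro ε
    have h := congrArg ((U⁻¹ * V⁻¹) • ·) (H.ww_comm ε)
    simp only [RingHom.comp_apply, ← map_sub, ← map_mul, ← Algebra.smul_def]
    rw [Ring.lie_def] at h
    simp only [smul_smul] at h
    convert h using 2
    · field_simp
    · simp
  · intro ε
    have h := congrArg ((U⁻¹ * V⁻¹) • ·) (H.ww_gg ε)
    simp only [RingHom.comp_apply, ← map_sub, ← map_mul, ← map_one (algebraMap F B),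
      ← Algebra.smul_def]
    rw [Ring.lie_def] at h
    simp only [smul_add (U⁻¹ * V⁻¹), smul_smul (U⁻¹ * V⁻¹), smul_zero] at h
    convert h using 3
    · field_simp
    · simp
    · field_simp
  · intro ε
    have h := congrArg ((U⁻¹ * V⁻¹) • ·) (H.gw_q ε)
    simp only [RingHom.comp_apply, mul_assoc, ← Algebra.smul_def, smul_mul_assoc]
    simp only [smul_zero] at h
    rw [← h]
    simp only [qComm, map_sub, map_inv₀]
    match_scalars <;> field_simp
  · intro ε
    have h := congrArg ((U⁻¹ * V⁻¹) • ·) (H.wg_q ε)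
    simp only [RingHom.comp_apply, mul_assoc, ← Algebra.smul_def, smul_mul_assoc]
    simp only [smul_zero] at h
    rw [← h]
    simp only [qComm, map_sub, map_inv₀]
    match_scalars <;> field_simp
  · exact H.gw_comm
  · exact H.gg_same
  · exact H.gg_mixed

end Transport
end Relations
end AqAlgebra
end

/-! ### Laurent series as algebras over scalar Laurent series -/

noncomputable section
namespace AqAlgebra
section LaurentAlgebra

/-- The ring homomorphism of Laurent series induced by one of the coefficients. -/
def laurentMap {R S : Type*} [Ring R] [Ring S] (f : R →+* S) :
    LaurentSeries R →+* LaurentSeries S where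
  toFun x := x.map f
  map_zero' := by ext; simp
  map_one' := by ext n; by_cases h : n = 0 <;> simp [HahnSeries.coeff_one, h]
  map_add' x y := by ext; simp
  map_mul' x y := HahnSeries.map_mul (f : R →ₙ+* S)

@[simp]
theorem coeff_laurentMap {R S : Type*} [Ring R] [Ring S] (f : R →+* S) (x : LaurentSeries R)
    (n : ℤ) : (laurentMap f x).coeff n = f (x.coeff n) := rfl

theorem commute_of_coeff {A : Type*} [Ring A] {f g : LaurentSeries A}
    (h : ∀ m n, Commute (f.coeff m) (g.coeff n)) : Commute f g := by
  ext d
  rw [HahnSeries.coeff_mul, HahnSeries.coeff_mul]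
  refine Finset.sum_equiv (Equiv.prodComm ℤ ℤ) ?_ ?_
  · intro p
    simp [add_comm]
    tauto
  · intro p _
    exact h _ _

variable {K A : Type*} [Field K] [Ring A] [Algebra K A]

/-- Laurent series over a `K`-algebra form an algebra over the scalar Laurent series. -/
instance laurentAlgebra : Algebra (LaurentSeries K) (LaurentSeries A) :=
  (laurentMap (algebraMap K A)).toAlgebra' fun _ _ =>
    commute_of_coeff fun _ _ => Algebra.commute_algebraMap_left _ _

theorem algebraMap_laurent :
    algebraMap (LaurentSeries K) (LaurentSeries A) = laurentMap (algebraMap K A) := rfl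

theorem inFst_eq (f : LaurentSeries A) : inFst f = laurentMap HahnSeries.C f := rfl

theorem laurentMap_inFst {R S : Type*} [Ring R] [Ring S] (f : R →+* S) (x : LaurentSeries R) :
    laurentMap (laurentMap f) (inFst x) = inFst (laurentMap f x) := by
  ext m n
  simp [inFst, HahnSeries.C_apply, HahnSeries.coeff_single, apply_ite f]

theorem laurentMap_inSnd {R S : Type*} [Ring R] [Ring S] (f : R →+* S) (x : LaurentSeries R) :
    laurentMap (laurentMap f) (inSnd x) = inSnd (laurentMap f x) := by
  ext m n
  by_cases h : m = 0 <;> simp [inSnd, HahnSeries.C_apply, h]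

theorem laurentMap_formalCurrent {R S : Type*} [Ring R] [Ring S] (f : R →+* S) (a : ℕ → R) :
    laurentMap f (formalCurrent a) = formalCurrent fun k => f (a k) := by
  ext n
  rw [coeff_laurentMap, formalCurrent, formalCurrent]
  rcases lt_or_ge n 0 with hn | hn
  · rw [HahnSeries.ofPowerSeries_apply, HahnSeries.ofPowerSeries_apply, HahnSeries.embDomain_of_notMem_range,
      HahnSeries.embDomain_of_notMem_range, map_zero] <;>
    · rintro ⟨m, hm⟩
      have : (m : ℤ) = n := hm
      omega
  · lift n to ℕ using hn
    rw [HahnSeries.ofPowerSeries_apply_coeff, HahnSeries.ofPowerSeries_apply_coeff]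
    cases n with
    | zero => simp
    | succ n => simp [PowerSeries.coeff_succ_X_mul]

theorem laurentMap_varInv {R S : Type*} [Ring R] [Ring S] (f : R →+* S) :
    laurentMap f (varInv R) = varInv S := by
  ext n
  by_cases h : n = -1 <;> simp [varInv, h]

/-- Scalars as constant series in two variables. -/
def const₂ (K : Type*) [Field K] : K →+* Laurent₂ K := HahnSeries.C.comp HahnSeries.C

/-- The relations use the coefficientwise action of `K`, the matrix argument that of the field
`Laurent₂ K`; the two agree on constants. -/
theorem const₂_smul (c : K) (f : Laurent₂ A) : const₂ K c • f = c • f := by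
  rw [Algebra.smul_def]
  have : algebraMap (Laurent₂ K) (Laurent₂ A) (const₂ K c)
      = HahnSeries.C (HahnSeries.C (algebraMap K A c)) := by
    ext m n
    by_cases h : m = 0 <;> by_cases h' : n = 0 <;> 
      simp [const₂, algebraMap_laurent, HahnSeries.C_apply, h, h']
  rw [this, HahnSeries.C_mul_eq_smul]
  ext m n
  rw [HahnSeries.coeff_smul, smul_eq_mul, HahnSeries.C_mul_eq_smul]
  simp [Algebra.smul_def]

end LaurentAlgebra

/-! ### The defining relations in the quotient algebra -/

section FormalRelations

variable {K : Type*} [Field K] (q ρ : K)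

/-- The images in `𝒜_q` of the two sides of a current relation agree. -/
theorem CurrentRel.laurentMap_eq {f g : Laurent₂ (FreeAlgebra K Gen)} (h : CurrentRel q ρ f g) :
    laurentMap (laurentMap (RingQuot.mkAlgHom K (CoeffRel q ρ)).toRingHom) f
      = laurentMap (laurentMap (RingQuot.mkAlgHom K (CoeffRel q ρ)).toRingHom) g := by
  ext m n
  exact RingQuot.mkAlgHom_rel K (CoeffRel.of h m n)

theorem laurentMap_smul {A A' : Type*} [Ring A] [Algebra K A] [Ring A'] [Algebra K A']
    (f : A →ₐ[K] A') (c : K) (x : Laurent₂ A) :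
    laurentMap (laurentMap f.toRingHom) (c • x)
      = const₂ K c • laurentMap (laurentMap f.toRingHom) x := by
  rw [const₂_smul]
  ext m n
  simp

/-- The formal current of the generators `W ε k`, `k ≥ 0`. -/
def formalW (ε : ℤˣ) : LaurentSeries (Aq q ρ) := formalCurrent fun k => gen q ρ (Gen.W ε k)

/-- The formal current of the generators `G ε k`, `k ≥ 0`. -/
def formalG (ε : ℤˣ) : LaurentSeries (Aq q ρ) := formalCurrent fun k => gen q ρ (Gen.G ε k)

set_option maxHeartbeats 1000000 in
theorem formal_exchangeRel :
    ExchangeRel (const₂ K q) (const₂ K ρ) (inFst (varInv K)) (inSnd (varInv K))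
      (fun ε => inFst (formalW q ρ ε)) (fun ε => inFst (formalG q ρ ε))
      (fun ε => inSnd (formalW q ρ ε)) (fun ε => inSnd (formalG q ρ ε)) := by
  have hrel := fun {f g} (h : CurrentRel q ρ f g) => CurrentRel.laurentMap_eq q ρ h
  have hWu : ∀ ε, laurentMap (laurentMap (RingQuot.mkAlgHom K (CoeffRel q ρ)).toRingHom) (Wu K ε)
      = inFst (formalW q ρ ε) := fun ε => by
    rw [Wu, laurentMap_inFst, freeW, laurentMap_formalCurrent]; rfl
  have hGu : ∀ ε, laurentMap (laurentMap (RingQuot.mkAlgHom K (CoeffRel q ρ)).toRingHom) (Gu K ε)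
      = inFst (formalG q ρ ε) := fun ε => by
    rw [Gu, laurentMap_inFst, freeG, laurentMap_formalCurrent]; rfl
  have hWv : ∀ ε, laurentMap (laurentMap (RingQuot.mkAlgHom K (CoeffRel q ρ)).toRingHom) (Wv K ε)
      = inSnd (formalW q ρ ε) := fun ε => by
    rw [Wv, laurentMap_inSnd, freeW, laurentMap_formalCurrent]; rfl
  have hGv : ∀ ε, laurentMap (laurentMap (RingQuot.mkAlgHom K (CoeffRel q ρ)).toRingHom) (Gv K ε)
      = inSnd (formalG q ρ ε) := fun ε => by
    rw [Gv, laurentMap_inSnd, freeG, laurentMap_formalCurrent]; rfl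
  have hU : laurentMap (laurentMap (RingQuot.mkAlgHom K (CoeffRel q ρ)).toRingHom) (UU K)
      = algebraMap (Laurent₂ K) (Laurent₂ (Aq q ρ)) (inFst (varInv K)) := by
    simp only [UU, laurentMap_inFst, laurentMap_varInv, algebraMap_laurent]
  have hV : laurentMap (laurentMap (RingQuot.mkAlgHom K (CoeffRel q ρ)).toRingHom) (VV K)
      = algebraMap (Laurent₂ K) (Laurent₂ (Aq q ρ)) (inSnd (varInv K)) := by
    simp only [VV, laurentMap_inSnd, laurentMap_varInv, algebraMap_laurent]
  have hsm := laurentMap_smul (K := K) (RingQuot.mkAlgHom K (CoeffRel q ρ))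
  generalize laurentMap (laurentMap (RingQuot.mkAlgHom K (CoeffRel q ρ)).toRingHom) = π at *
  constructor
  · intro ε
    simpa only [Ring.lie_def, map_sub, map_mul, map_zero, hWu, hWv] using hrel (.ww_same ε)
  · simpa only [Ring.lie_def, map_sub, map_add, map_mul, map_zero, hWu, hWv] using hrel .ww_mixed
  · intro ε
    have h := hrel (.ww_comm ε)
    simpa only [Ring.lie_def, map_sub, map_add, map_mul, map_zero, map_one, map_div₀, map_inv₀,
      map_pow, hWu, hWv, hGu, hGv, hU, hV, hsm, Algebra.smul_def] using h
  · intro ε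
    have h := hrel (.ww_gg ε)
    simpa only [Ring.lie_def, map_sub, map_add, map_mul, map_zero, map_one, map_div₀, map_inv₀,
      map_pow, hWu, hWv, hGu, hGv, hU, hV, hsm, Algebra.smul_def] using h
  · intro ε
    have h := hrel (.gw_q ε)
    simpa only [qComm, Ring.lie_def, map_sub, map_add, map_mul, map_zero, map_one, map_div₀,
      map_inv₀, map_pow, hWu, hWv, hGu, hGv, hU, hV, hsm, Algebra.smul_def] using h
  · intro ε
    have h := hrel (.wg_q ε)
    simpa only [qComm, Ring.lie_def, map_sub, map_add, map_mul, map_zero, map_one, map_div₀,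
      map_inv₀, map_pow, hWu, hWv, hGu, hGv, hU, hV, hsm, Algebra.smul_def] using h
  · intro η ε
    simpa only [Ring.lie_def, map_sub, map_add, map_mul, map_zero, hWu, hWv, hGu, hGv] using
      hrel (.gw_comm η ε)
  · intro ε
    simpa only [Ring.lie_def, map_sub, map_mul, map_zero, hGu, hGv] using hrel (.gg_same ε)
  · simpa only [Ring.lie_def, map_sub, map_add, map_mul, map_zero, hGu, hGv] using hrel .gg_mixed

end FormalRelations
end AqAlgebra
end

/-! ### Evaluation of two-variable series -/

noncomputable section
namespace AqAlgebra
section Evaluation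
open PowerSeries

variable {K A : Type*} [Field K] [Ring A] [Algebra K A]

/-- Power series in two variables as Laurent series. -/
def toLaurent₂ (A : Type*) [Ring A] : A⟦X⟧⟦X⟧ →+* Laurent₂ A :=
  (laurentMap (HahnSeries.ofPowerSeries ℤ A)).comp (HahnSeries.ofPowerSeries ℤ A⟦X⟧)

theorem coeff_ofPowerSeries_of_neg {R : Type*} [Ring R] (f : R⟦X⟧) {n : ℤ} (hn : n < 0) :
    (HahnSeries.ofPowerSeries ℤ R f).coeff n = 0 := by
  rw [HahnSeries.ofPowerSeries_apply, HahnSeries.embDomain_of_notMem_range]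
  rintro ⟨m, hm⟩
  have : (m : ℤ) = n := hm
  omega

theorem laurentMap_ofPowerSeries {R S : Type*} [Ring R] [Ring S] (g : R →+* S) (f : R⟦X⟧) :
    laurentMap g (HahnSeries.ofPowerSeries ℤ R f)
      = HahnSeries.ofPowerSeries ℤ S (PowerSeries.map g f) := by
  ext n
  rw [coeff_laurentMap]
  rcases lt_or_ge n 0 with hn | hn
  · rw [coeff_ofPowerSeries_of_neg _ hn, coeff_ofPowerSeries_of_neg _ hn, map_zero]
  · lift n to ℕ using hn
    rw [HahnSeries.ofPowerSeries_apply_coeff, HahnSeries.ofPowerSeries_apply_coeff, coeff_map]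

theorem toLaurent₂_injective : Function.Injective (toLaurent₂ A) := by
  intro f g h
  apply HahnSeries.ofPowerSeries_injective (Γ := ℤ)
  refine HahnSeries.ext (funext fun m => ?_)
  apply HahnSeries.ofPowerSeries_injective (Γ := ℤ)
  exact congrArg (fun z => z.coeff m) h

theorem toLaurent₂_C (f : A⟦X⟧) :
    toLaurent₂ A (C f) = inSnd (HahnSeries.ofPowerSeries ℤ A f) := by
  rw [toLaurent₂, RingHom.comp_apply, laurentMap_ofPowerSeries, map_C, HahnSeries.ofPowerSeries_C,
    inSnd]

theorem toLaurent₂_map_C (f : A⟦X⟧) :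
    toLaurent₂ A (PowerSeries.map C f) = inFst (HahnSeries.ofPowerSeries ℤ A f) := by
  rw [toLaurent₂, RingHom.comp_apply, laurentMap_ofPowerSeries]
  change _ = laurentMap (HahnSeries.C : A →+* LaurentSeries A) _
  rw [laurentMap_ofPowerSeries]
  congr 1
  ext n : 1
  simp [HahnSeries.ofPowerSeries_C]

theorem toLaurent₂_X : toLaurent₂ A X = inFst (var A) := by
  rw [var, ← HahnSeries.ofPowerSeries_X, ← toLaurent₂_map_C, map_X]

theorem constantCoeff_map_eq_zero {R S : Type*} [Ring R] [Ring S] (g : R →+* S) {T : R⟦X⟧}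
    (hT : constantCoeff T = 0) : constantCoeff (PowerSeries.map g T) = 0 := by
  rw [← coeff_zero_eq_constantCoeff_apply, coeff_map, coeff_zero_eq_constantCoeff_apply, hT,
    map_zero]

theorem commute_map_algebraMap (f : A⟦X⟧) (T : K⟦X⟧) :
    Commute f (PowerSeries.map (algebraMap K A) T) := by
  apply HahnSeries.ofPowerSeries_injective (Γ := ℤ)
  rw [map_mul, map_mul, ← laurentMap_ofPowerSeries, ← algebraMap_laurent, Algebra.commutes]

/-- The substitution of a scalar power series without constant term for the variable. -/
def substScalar (A : Type*) [Ring A] [Algebra K A] (T : K⟦X⟧) (hT : constantCoeff T = 0) :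
    A⟦X⟧ →+* A⟦X⟧ :=
  substHom C (PowerSeries.map (algebraMap K A) T) (constantCoeff_map_eq_zero _ hT)
    fun _ => commute_map_algebraMap _ _

/-- This identifies `currentAt` with the value of a ring homomorphism on the formal current, so that
polynomial relations between currents survive evaluation. -/
theorem ofPowerSeries_substScalar (T : K⟦X⟧) (hT : constantCoeff T = 0) (a : ℕ → A) :
    HahnSeries.ofPowerSeries ℤ A (substScalar A T hT (X * PowerSeries.mk a))
      = currentAt a (HahnSeries.ofPowerSeries ℤ K T) := by
  rw [currentAt]
  congr 1
  ext n
  change coeff n (substFun _ _ _) = _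
  rw [substFun, coeff_mk, coeff_mk, Finset.sum_range_succ', map_add, map_sum]
  simp only [coeff_succ_X_mul, coeff_zero_X_mul, coeff_mk, map_zero, zero_mul, add_zero,
    ← map_pow, coeff_C_mul, coeff_map, HahnSeries.ofPowerSeries_apply_coeff, Algebra.smul_def]
  exact Finset.sum_congr rfl fun k _ => (Algebra.commutes _ _).symm

theorem exists_ofPowerSeries_eq (T : LaurentSeries K) (hT : ((1 : ℤ) : WithTop ℤ) ≤ T.orderTop) :
    ∃ S : K⟦X⟧, constantCoeff S = 0 ∧ HahnSeries.ofPowerSeries ℤ K S = T := by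
  have h0 : ∀ n : ℤ, n < 1 → T.coeff n = 0 := fun n hn =>
    HahnSeries.coeff_eq_zero_of_lt_orderTop
      (lt_of_lt_of_le (WithTop.coe_lt_coe.mpr hn) hT)
  refine ⟨PowerSeries.mk fun n => T.coeff n, ?_, ?_⟩
  · rw [← coeff_zero_eq_constantCoeff_apply, coeff_mk]
    exact h0 0 (by norm_num)
  · ext n
    rcases lt_or_ge n 0 with hn | hn
    · rw [coeff_ofPowerSeries_of_neg _ hn, h0 n (by omega)]
    · lift n to ℕ using hn
      rw [HahnSeries.ofPowerSeries_apply_coeff, coeff_mk]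

theorem commute_C_map_C (f : A⟦X⟧) (S : K⟦X⟧) :
    Commute (C f) (PowerSeries.map C (PowerSeries.map (algebraMap K A) S)) := by
  ext n m
  simp [Algebra.commutes]

/-- Evaluation of series in two variables at scalar series in two independent variables. -/
def evalIndep (A : Type*) [Ring A] [Algebra K A] (S T : K⟦X⟧) (hS : constantCoeff S = 0)
    (hT : constantCoeff T = 0) : A⟦X⟧⟦X⟧ →+* Laurent₂ A :=
  (toLaurent₂ A).comp (substHom ((C (R := A⟦X⟧)).comp (substScalar A T hT))
    (PowerSeries.map C (PowerSeries.map (algebraMap K A) S))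
    (constantCoeff_map_eq_zero _ (constantCoeff_map_eq_zero _ hS)) fun _ => commute_C_map_C _ _)

/-- Evaluation of series in two variables at scalar series in one variable. -/
def evalSame (A : Type*) [Ring A] [Algebra K A] (S T : K⟦X⟧) (hS : constantCoeff S = 0)
    (hT : constantCoeff T = 0) : A⟦X⟧⟦X⟧ →+* Laurent₂ A :=
  ((laurentMap HahnSeries.C).comp (HahnSeries.ofPowerSeries ℤ A)).comp
    (substHom (substScalar A T hT)
      (PowerSeries.map (algebraMap K A) S) (constantCoeff_map_eq_zero _ hS)
      fun _ => commute_map_algebraMap _ _)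

variable (S T : K⟦X⟧) (hS : constantCoeff S = 0) (hT : constantCoeff T = 0)

theorem evalIndep_C (f : A⟦X⟧) : evalIndep A S T hS hT (C f)
    = inSnd (HahnSeries.ofPowerSeries ℤ A (substScalar A T hT f)) := by
  rw [evalIndep, RingHom.comp_apply, substHom_C, RingHom.comp_apply, toLaurent₂_C]

theorem evalSame_C (f : A⟦X⟧) : evalSame A S T hS hT (C f)
    = inFst (HahnSeries.ofPowerSeries ℤ A (substScalar A T hT f)) := by
  rw [evalSame, RingHom.comp_apply, substHom_C]
  rfl

theorem substScalar_C (a : A) : substScalar A T hT (C a) = C a := substHom_C _ _ _ _ _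

theorem substScalar_X : substScalar A T hT X = PowerSeries.map (algebraMap K A) T :=
  substHom_X _ _ _ _

theorem evalIndep_map_C (f : A⟦X⟧) : evalIndep A S T hS hT (PowerSeries.map C f)
    = inFst (HahnSeries.ofPowerSeries ℤ A (substScalar A S hS f)) := by
  rw [evalIndep, RingHom.comp_apply, substHom_map, ← toLaurent₂_map_C]
  congr 1
  refine Eq.trans ?_ (map_substHom _ _ _ _ _ _).symm
  change substFun _ _ f = substFun _ _ f
  congr 1
  ext r : 1
  simp [substScalar_C]

theorem evalSame_map_C (f : A⟦X⟧) : evalSame A S T hS hT (PowerSeries.map C f)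
    = inFst (HahnSeries.ofPowerSeries ℤ A (substScalar A S hS f)) := by
  rw [evalSame, RingHom.comp_apply, substHom_map]
  change inFst (HahnSeries.ofPowerSeries ℤ A (substFun ((substScalar A T hT).comp C) _ f))
    = inFst (HahnSeries.ofPowerSeries ℤ A (substFun C _ f))
  rw [show (substScalar A T hT).comp C = C from RingHom.ext fun _ => substScalar_C T hT _]

theorem inFst_algebraMap (f : LaurentSeries K) :
    inFst (algebraMap (LaurentSeries K) (LaurentSeries A) f)
      = algebraMap (Laurent₂ K) (Laurent₂ A) (inFst f) :=
  (laurentMap_inFst _ _).symm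

theorem inSnd_algebraMap (f : LaurentSeries K) :
    inSnd (algebraMap (LaurentSeries K) (LaurentSeries A) f)
      = algebraMap (Laurent₂ K) (Laurent₂ A) (inSnd f) :=
  (laurentMap_inSnd _ _).symm

theorem evalIndep_X : evalIndep A S T hS hT X
    = algebraMap (Laurent₂ K) (Laurent₂ A) (inFst (HahnSeries.ofPowerSeries ℤ K S)) := by
  rw [← map_X (C (R := A)), evalIndep_map_C, substScalar_X, ← laurentMap_ofPowerSeries,
    ← inFst_algebraMap, algebraMap_laurent]

theorem evalSame_X : evalSame A S T hS hT X
    = algebraMap (Laurent₂ K) (Laurent₂ A) (inFst (HahnSeries.ofPowerSeries ℤ K S)) := by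
  rw [← map_X (C (R := A)), evalSame_map_C, substScalar_X, ← laurentMap_ofPowerSeries,
    ← inFst_algebraMap, algebraMap_laurent]

/-- Scalars as constant power series in two variables. -/
def constPS (K A : Type*) [Field K] [Ring A] [Algebra K A] : K →+* A⟦X⟧⟦X⟧ :=
  ((C (R := A⟦X⟧)).comp (C (R := A))).comp (algebraMap K A)

theorem algebraMap_const₂ (c : K) : algebraMap (Laurent₂ K) (Laurent₂ A) (const₂ K c)
    = HahnSeries.C (HahnSeries.C (algebraMap K A c)) := by
  ext m n
  by_cases h : m = 0 <;> by_cases h' : n = 0 <;>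
    simp [const₂, algebraMap_laurent, HahnSeries.C_apply, h, h']

theorem toLaurent₂_constPS : (toLaurent₂ A).comp (constPS K A)
    = (algebraMap (Laurent₂ K) (Laurent₂ A)).comp (const₂ K) := by
  ext1 c
  rw [RingHom.comp_apply, RingHom.comp_apply, algebraMap_const₂]
  simp [constPS, toLaurent₂_C, HahnSeries.ofPowerSeries_C, inSnd]

theorem evalIndep_constPS : (evalIndep A S T hS hT).comp (constPS K A)
    = (algebraMap (Laurent₂ K) (Laurent₂ A)).comp (const₂ K) := by
  ext1 c
  rw [RingHom.comp_apply, RingHom.comp_apply, algebraMap_const₂]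
  simp [constPS, evalIndep_C, substScalar_C, HahnSeries.ofPowerSeries_C, inSnd]

theorem evalSame_constPS : (evalSame A S T hS hT).comp (constPS K A)
    = (algebraMap (Laurent₂ K) (Laurent₂ A)).comp (const₂ K) := by
  ext1 c
  rw [RingHom.comp_apply, RingHom.comp_apply, algebraMap_const₂]
  simp only [constPS, RingHom.comp_apply, evalSame_C, substScalar_C, HahnSeries.ofPowerSeries_C]
  ext m n
  by_cases h : m = 0 <;> simp [inFst, HahnSeries.C_apply, h]

end Evaluation
end AqAlgebra
end

/-! ### Relations between currents at given points -/

noncomputable section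
namespace AqAlgebra
section Currents

variable {K : Type*} [Field K] (q ρ : K)

-- All series occurring here are power series in `U⁻¹` and `V⁻¹`, so the Laurent identities can be
-- pulled back along the injective `toLaurent₂`.
open PowerSeries in
theorem formal_polyRel :
    PolyRel q ρ (constPS K (Aq q ρ)) X (C X)
      (fun ε => PowerSeries.map C (X * PowerSeries.mk fun k => gen q ρ (Gen.W ε k)))
      (fun ε => PowerSeries.map C (X * PowerSeries.mk fun k => gen q ρ (Gen.G ε k)))
      (fun ε => C (X * PowerSeries.mk fun k => gen q ρ (Gen.W ε k)))
      (fun ε => C (X * PowerSeries.mk fun k => gen q ρ (Gen.G ε k))) := by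
  have hinv : ∀ L : Type _, [Field L] → (varInv L)⁻¹ = var L := fun L _ => by
    rw [varInv, var, HahnSeries.inv_single]; simp
  have hne : varInv K ≠ 0 := by simp [varInv]
  have h := (formal_exchangeRel q ρ).polyRel (const₂ K) _ _
    (by rw [inFst_eq, map_ne_zero]; exact hne)
    (by rw [inSnd, map_ne_zero]; exact hne)
  refine PolyRel.of_map (toLaurent₂ (Aq q ρ)) toLaurent₂_injective ?_
  rw [toLaurent₂_constPS]
  simp only [toLaurent₂_map_C, toLaurent₂_C]
  convert h using 1
  · rw [toLaurent₂_X, inFst_eq (A := K), ← map_inv₀, ← inFst_eq, hinv, ← inFst_algebraMap]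
    congr 1
    ext n
    by_cases hn : n = 1 <;> simp [var, algebraMap_laurent, hn]
  · rw [HahnSeries.ofPowerSeries_X, inSnd, inSnd, ← map_inv₀, hinv]
    change _ = algebraMap (Laurent₂ K) (Laurent₂ (Aq q ρ)) (inSnd (var K))
    rw [← inSnd_algebraMap, inSnd]
    congr 1
    ext n
    by_cases hn : n = 1 <;> simp [var, algebraMap_laurent, hn]
  all_goals rfl

variable {q ρ}

theorem exchangeRel_indep (u v : LaurentSeries K) (hu : spectral q u ≠ 0) (hv : spectral q v ≠ 0)
    (hu' : ((1 : ℤ) : WithTop ℤ) ≤ ((spectral q u)⁻¹).orderTop)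
    (hv' : ((1 : ℤ) : WithTop ℤ) ≤ ((spectral q v)⁻¹).orderTop) :
    ExchangeRel (const₂ K q) (const₂ K ρ) (inFst (spectral q u)) (inSnd (spectral q v))
      (fun ε => inFst (currentW q ρ ε u)) (fun ε => inFst (currentG q ρ ε u))
      (fun ε => inSnd (currentW q ρ ε v)) (fun ε => inSnd (currentG q ρ ε v)) := by
  obtain ⟨S, hS, hSu⟩ := exists_ofPowerSeries_eq _ hu'
  obtain ⟨T, hT, hTv⟩ := exists_ofPowerSeries_eq _ hv'
  have h := (formal_polyRel q ρ).map (evalIndep (Aq q ρ) S T hS hT)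
  refine PolyRel.exchangeRel (const₂ K) _ _ (by rw [inFst_eq, map_ne_zero]; exact hu)
    (by rw [inSnd, map_ne_zero]; exact hv) ?_
  simp only [evalIndep_map_C, evalIndep_C, evalIndep_constPS, evalIndep_X, substScalar_X,
    ofPowerSeries_substScalar, hSu, hTv] at h
  rw [inFst_eq (A := K), ← map_inv₀, ← inFst_eq, inSnd, ← map_inv₀]
  convert h using 1
  rw [← laurentMap_ofPowerSeries, hTv, ← algebraMap_laurent, inSnd_algebraMap, inSnd]
  all_goals rfl

/-- Δ(u) multiplies currents at `u` and `uq`, so both formal variables must be specialised to series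
in one variable. The result is placed in the first variable of `Laurent₂`, next to the relations
with `v`. -/
theorem exchangeRel_same (u v : LaurentSeries K) (hu : spectral q u ≠ 0) (hv : spectral q v ≠ 0)
    (hu' : ((1 : ℤ) : WithTop ℤ) ≤ ((spectral q u)⁻¹).orderTop)
    (hv' : ((1 : ℤ) : WithTop ℤ) ≤ ((spectral q v)⁻¹).orderTop) :
    ExchangeRel (const₂ K q) (const₂ K ρ) (inFst (spectral q u)) (inFst (spectral q v))
      (fun ε => inFst (currentW q ρ ε u)) (fun ε => inFst (currentG q ρ ε u))
      (fun ε => inFst (currentW q ρ ε v)) (fun ε => inFst (currentG q ρ ε v)) := by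
  obtain ⟨S, hS, hSu⟩ := exists_ofPowerSeries_eq _ hu'
  obtain ⟨T, hT, hTv⟩ := exists_ofPowerSeries_eq _ hv'
  have h := (formal_polyRel q ρ).map (evalSame (Aq q ρ) S T hS hT)
  refine PolyRel.exchangeRel (const₂ K) _ _ (by rw [inFst_eq, map_ne_zero]; exact hu)
    (by rw [inFst_eq, map_ne_zero]; exact hv) ?_
  simp only [evalSame_map_C, evalSame_C, evalSame_constPS, evalSame_X, substScalar_X,
    ofPowerSeries_substScalar, hSu, hTv] at h
  rw [inFst_eq (A := K), inFst_eq (A := K), ← map_inv₀, ← map_inv₀, ← inFst_eq, ← inFst_eq]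
  convert h using 1
  rw [← laurentMap_ofPowerSeries, hTv, ← algebraMap_laurent, inFst_algebraMap]
  all_goals rfl

end Currents
end AqAlgebra
end

/-! ### Centrality of the coefficients -/

noncomputable section
namespace AqAlgebra
section Center

variable {K : Type*} [Field K]

theorem single_ne_one {R : Type*} [Ring R] [Nontrivial R] {m : ℤ} (hm : m ≠ 0) (y : R) :
    HahnSeries.single m y ≠ (1 : LaurentSeries R) := by
  intro h
  have := congrArg (fun z => z.coeff 0) h
  simp [HahnSeries.coeff_single_of_ne hm.symm] at this

theorem sub_inv_ne_zero {F : Type*} [Field F] {x : F} (hx : x ≠ 0) (h : x ^ 2 ≠ 1) :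
    x - x⁻¹ ≠ 0 := by
  intro h0
  apply h
  rw [sub_eq_zero] at h0
  rw [pow_two]
  nth_rewrite 2 [h0]
  exact mul_inv_cancel₀ hx

theorem inFst_C (c : K) : inFst (HahnSeries.C c : LaurentSeries K) = const₂ K c := by
  ext m n
  by_cases h : m = 0 <;> simp [inFst, const₂, HahnSeries.C_apply, h]

theorem inSnd_C (c : K) : inSnd (HahnSeries.C c : LaurentSeries K) = const₂ K c := rfl

theorem inFst_single {R : Type*} [Ring R] (m : ℤ) (c : R) :
    inFst (HahnSeries.single m c : LaurentSeries R) = HahnSeries.single m (HahnSeries.C c) := by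
  ext k n
  by_cases h : k = m <;> simp [inFst, HahnSeries.C_apply, h]

theorem spectralValue_inFst (q : K) (u : LaurentSeries K) :
    spectralValue (const₂ K q) (inFst u) = inFst (spectral q u) := by
  simp only [spectralValue, spectral, ← inFst_C]
  simp only [inFst_eq, map_div₀, map_add, map_mul, map_pow, map_inv₀]

theorem spectralValue_inSnd (q : K) (u : LaurentSeries K) :
    spectralValue (const₂ K q) (inSnd u) = inSnd (spectral q u) := by
  simp only [spectralValue, spectral, ← inSnd_C, inSnd]
  simp only [map_div₀, map_add, map_mul, map_pow, map_inv₀]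

theorem spectral_ne_zero (q c : K) (hq : q ≠ 0) (hqs : q + q⁻¹ ≠ 0) (hc : c ≠ 0)
    (u : LaurentSeries K) (hu : u = varInv K * HahnSeries.C c ∨ u = var K * HahnSeries.C c) :
    spectral q u ≠ 0 := by
  have single_inv : ∀ (m : ℤ) (d : K), (HahnSeries.single m d : LaurentSeries K)⁻¹
      = HahnSeries.single (-m) d⁻¹ := fun m d => HahnSeries.inv_single m d
  refine div_ne_zero (fun h => ?_) ((map_ne_zero HahnSeries.C).mpr hqs)
  have h' := congrArg (fun z => z.coeff (-2)) h
  rcases hu with rfl | rfl <;>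
  · simp only [varInv, var, HahnSeries.C_apply, HahnSeries.single_mul_single, single_inv,
      HahnSeries.single_pow] at h'
    simp [hq, hc] at h'

theorem inFst_smul {A : Type*} [Ring A] [Algebra K A] (c : K) (f : LaurentSeries A) :
    inFst (c • f) = const₂ K c • inFst f := by
  rw [const₂_smul]
  ext m n
  by_cases h : n = 0 <;> simp [inFst, HahnSeries.C_apply, h]

theorem inFst_scalar {A : Type*} [Ring A] [Algebra K A] (f : LaurentSeries K) :
    inFst (scalar A f) = algebraMap (Laurent₂ K) (Laurent₂ A) (inFst f) :=
  inFst_algebraMap f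

section InFst

variable {A : Type*} [Ring A]

theorem inFst_add (f g : LaurentSeries A) : inFst (f + g) = inFst f + inFst g :=
  map_add (laurentMap (HahnSeries.C : A →+* LaurentSeries A)) f g

theorem inFst_sub (f g : LaurentSeries A) : inFst (f - g) = inFst f - inFst g :=
  map_sub (laurentMap (HahnSeries.C : A →+* LaurentSeries A)) f g

theorem inFst_neg (f : LaurentSeries A) : inFst (-f) = -inFst f :=
  map_neg (laurentMap (HahnSeries.C : A →+* LaurentSeries A)) f

theorem inFst_mul (f g : LaurentSeries A) : inFst (f * g) = inFst f * inFst g :=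
  map_mul (laurentMap (HahnSeries.C : A →+* LaurentSeries A)) f g

theorem inFst_pow (f : LaurentSeries A) (n : ℕ) : inFst (f ^ n) = inFst f ^ n :=
  map_pow (laurentMap (HahnSeries.C : A →+* LaurentSeries A)) f n

theorem inFst_inv (f : LaurentSeries K) : inFst f⁻¹ = (inFst f)⁻¹ :=
  map_inv₀ (laurentMap (HahnSeries.C : K →+* LaurentSeries K)) f

end InFst

theorem inFst_Delta (q ρ : K) (u : LaurentSeries K) :
    inFst (Delta q ρ u) = deltaValue (const₂ K q) (const₂ K ρ) (inFst u)
      (fun ε => inFst (currentW q ρ ε u)) (fun ε => inFst (currentG q ρ ε u))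
      (fun ε => inFst (currentW q ρ ε (shift q u)))
      (fun ε => inFst (currentG q ρ ε (shift q u))) := by
  have hshift : inFst (shift q u) = inFst u * const₂ K q := by
    rw [shift, inFst_mul, inFst_C]
  simp only [Delta, inFst_sub, inFst_add, inFst_neg, inFst_smul, inFst_mul, inFst_scalar]
  rw [← Algebra.smul_def]
  simp only [deltaValue, inFst_pow, inFst_inv, hshift, map_mul, map_add, map_sub, map_div₀,
    map_inv₀, map_pow]

/-- Triangularity: in degree `(k + 1) * T.order` the terms `a j` with `j > k` are absent, those with
`j < k` commute with `z` by induction, and `a k` has a nonzero scalar coefficient, the leading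
coefficient of `T ^ (k + 1)`. -/
theorem commute_of_commute_currentAt {A : Type*} [Ring A] [Algebra K A] (z : A) (a : ℕ → A)
    (T : LaurentSeries K) (hT0 : T ≠ 0) (hT : ((1 : ℤ) : WithTop ℤ) ≤ T.orderTop)
    (h : ∀ n, Commute z ((currentAt a T).coeff n)) (k : ℕ) : Commute z (a k) := by
  have ht : 1 ≤ T.order := by
    rw [← HahnSeries.order_eq_orderTop_of_ne_zero hT0] at hT
    exact_mod_cast hT
  have hpow : ∀ j : ℕ, (T ^ j).order = j * T.order := by
    intro j
    rw [HahnSeries.order_pow, nsmul_eq_mul]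
  have hlow : ∀ (j : ℕ) (n : ℤ), n < j * T.order → (T ^ j).coeff n = 0 := fun j n hn =>
    HahnSeries.coeff_eq_zero_of_lt_order (by rwa [hpow])
  induction k using Nat.strong_induction_on with
  | _ k ih =>
    obtain ⟨N, hN⟩ : ∃ N : ℕ, (N : ℤ) = ((k + 1 : ℕ) : ℤ) * T.order :=
      ⟨_, Int.toNat_of_nonneg (by positivity)⟩
    have hkN : k < N := by
      have : ((k + 1 : ℕ) : ℤ) * 1 ≤ ((k + 1 : ℕ) : ℤ) * T.order := by gcongr
      omega
    have hc := h N
    rw [currentAt, HahnSeries.ofPowerSeries_apply_coeff, PowerSeries.coeff_mk,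
      ← Finset.add_sum_erase _ _ (Finset.mem_range.mpr hkN)] at hc
    have hrest : Commute z (∑ j ∈ (Finset.range N).erase k, (T ^ (j + 1)).coeff (N : ℤ) • a j) := by
      refine Commute.sum_right _ _ _ fun j hj => ?_
      rcases lt_or_gt_of_ne (Finset.ne_of_mem_erase hj) with hjk | hjk
      · exact (ih j hjk).smul_right _
      · rw [hlow, zero_smul]
        · exact Commute.zero_right _
        · rw [hN]
          have : (k : ℤ) < j := by exact_mod_cast hjk
          push_cast
          nlinarith
    have hk : Commute z ((T ^ (k + 1)).coeff (N : ℤ) • a k) := by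
      have := hc.sub_right hrest
      rwa [add_sub_cancel_right] at this
    have hne : (T ^ (k + 1)).coeff (N : ℤ) ≠ 0 := by
      rw [hN, ← hpow]
      exact HahnSeries.coeff_order_eq_zero.not.mpr (pow_ne_zero _ hT0)
    have := hk.smul_right ((T ^ (k + 1)).coeff (N : ℤ))⁻¹
    rwa [inv_smul_smul₀ hne] at this

theorem coeff_commute_of_commute {A : Type*} [Ring A] {f g : LaurentSeries A}
    (h : Commute (inFst f) (inSnd g)) (m n : ℤ) : Commute (f.coeff m) (g.coeff n) := by
  have h1 := congrArg (fun z => (z.coeff m).coeff n) h.eq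
  rw [commute_iff_eq]
  simpa [inSnd, HahnSeries.C_apply, HahnSeries.coeff_mul_single_zero,
    HahnSeries.coeff_single_zero_mul, inFst] using h1

theorem mem_center_of_commute_gen (q ρ : K) (z : Aq q ρ) (h : ∀ g, Commute z (gen q ρ g)) :
    z ∈ Subalgebra.center K (Aq q ρ) := by
  rw [Subalgebra.mem_center_iff]
  intro b
  obtain ⟨b, rfl⟩ := RingQuot.mkAlgHom_surjective K (CoeffRel q ρ) b
  suffices Commute z (RingQuot.mkAlgHom K (CoeffRel q ρ) b) from this.eq.symm
  induction b using FreeAlgebra.induction with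
  | grade0 r => rw [AlgHom.commutes]; exact (Algebra.commutes r z).symm
  | grade1 g => exact h g
  | mul a b ha hb => rw [map_mul]; exact ha.mul_right hb
  | add a b ha hb => rw [map_add]; exact ha.add_right hb

theorem commute_Delta (q ρ : K) (hq0 : q ≠ 0) (hq : ∀ n : ℕ, 0 < n → q ^ n ≠ 1) (hρ : ρ ≠ 0)
    (u v : LaurentSeries K) (hu : u = varInv K ∨ u = var K) (hv : v = varInv K ∨ v = var K)
    (ε : ℤˣ) :
    Commute (inFst (Delta q ρ u)) (inSnd (currentW q ρ ε v)) ∧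
      Commute (inFst (Delta q ρ u)) (inSnd (currentG q ρ ε v)) := by
  -- Otherwise `q ^ 2 = -1`, and `q` would be a fourth root of unity.
  have hqs : q + q⁻¹ ≠ 0 := by
    intro h
    apply hq 4 (by norm_num)
    field_simp at h
    linear_combination (q ^ 2 - 1) * h
  have hqd : q - q⁻¹ ≠ 0 := sub_inv_ne_zero hq0 (hq 2 (by norm_num))
  have hu1 : u = varInv K * HahnSeries.C 1 ∨ u = var K * HahnSeries.C 1 := by simpa using hu
  have hv1 : v = varInv K * HahnSeries.C 1 ∨ v = var K * HahnSeries.C 1 := by simpa using hv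
  have hs : shift q u = varInv K * HahnSeries.C q ∨ shift q u = var K * HahnSeries.C q := by
    rcases hu with rfl | rfl
    · exact Or.inl rfl
    · exact Or.inr rfl
  have su := spectral_ne_zero q 1 hq0 hqs one_ne_zero u hu1
  have sv := spectral_ne_zero q 1 hq0 hqs one_ne_zero v hv1
  have ss := spectral_ne_zero q q hq0 hqs hq0 _ hs
  have ou := one_le_orderTop_spectral_inv q 1 hq0 one_ne_zero u hu1
  have ov := one_le_orderTop_spectral_inv q 1 hq0 one_ne_zero v hv1
  have os := one_le_orderTop_spectral_inv q q hq0 hq0 _ hs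
  have h₁₂ := exchangeRel_same (ρ := ρ) u (shift q u) su ss ou os
  have h₁₃ := exchangeRel_indep (ρ := ρ) u v su sv ou ov
  have h₂₃ := exchangeRel_indep (ρ := ρ) (shift q u) v ss sv os ov
  rw [← spectralValue_inFst, ← spectralValue_inFst] at h₁₂
  rw [← spectralValue_inFst, ← spectralValue_inSnd] at h₁₃ h₂₃
  have hshift : inFst (shift q u) = inFst u * const₂ K q := by
    rw [shift, ← inFst_C]
    exact map_mul (laurentMap (HahnSeries.C : K →+* LaurentSeries K)) _ _
  rw [hshift] at h₁₂ h₂₃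
  obtain ⟨a, ha, hua⟩ : ∃ a : ℤ, a ≠ 0 ∧ inFst u = HahnSeries.single a 1 := by
    rcases hu with rfl | rfl
    · exact ⟨-1, by norm_num, by rw [varInv, inFst_single, map_one]⟩
    · exact ⟨1, by norm_num, by rw [var, inFst_single, map_one]⟩
  obtain ⟨b, hb, hvb⟩ : ∃ b : ℤ, b ≠ 0 ∧
      inSnd v = HahnSeries.single 0 (HahnSeries.single b (1 : K)) := by
    rcases hv with rfl | rfl
    · exact ⟨-1, by norm_num, rfl⟩
    · exact ⟨1, by norm_num, rfl⟩
  have hu0 : inFst u ≠ 0 := by rw [hua]; simp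
  have hv0 : inSnd v ≠ 0 := by rw [hvb]; simp
  have hq0' : const₂ K q ≠ 0 := by simpa using hq0
  have hqF : const₂ K q = HahnSeries.single 0 (HahnSeries.single 0 q) := rfl
  have single_inv : ∀ (m : ℤ) (d : LaurentSeries K), (HahnSeries.single m d : Laurent₂ K)⁻¹
      = HahnSeries.single (-m) d⁻¹ := fun m d => HahnSeries.inv_single m d
  rw [inFst_Delta]
  refine commute_deltaValue (const₂ K q) (const₂ K ρ) (inFst u) (inSnd v) hq0' ?_ ?_ ?_ hu0 hv0
    ?_ ?_ ?_ ?_ _ _ _ _ _ _ h₁₂ h₁₃ h₂₃ ε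
  · rw [← map_inv₀, ← map_add]; exact (map_ne_zero _).mpr hqs
  · rw [← map_inv₀, ← map_sub]; exact (map_ne_zero _).mpr hqd
  · exact (map_ne_zero _).mpr hρ
  -- Every quantity to be shown nonzero is a product of terms `x - x⁻¹`, where `x` is a nonzero
  -- scalar times a nontrivial monomial in two independent variables, so that `x ^ 2 ≠ 1`. Wherever
  -- `u` occurs the exponent of the outer variable is nonzero.
  · refine sub_inv_ne_zero (by simp [hq0', hu0]) ?_
    rw [hua, hqF]
    simp only [HahnSeries.single_pow, HahnSeries.single_mul_single]
    exact single_ne_one (by simpa using ha) _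
  · refine sub_inv_ne_zero (by simp [hq0', hv0]) ?_
    rw [hvb, hqF]
    simp only [HahnSeries.single_pow, HahnSeries.single_mul_single]
    intro h
    -- This monomial involves `v` alone, so it is constant in the outer variable and is compared
    -- with 1 through its outer coefficient of degree 0.
    have h' := congrArg (fun z => z.coeff 0) h
    simp only [nsmul_zero, add_zero, HahnSeries.coeff_single_same, HahnSeries.coeff_one,
      if_true] at h'
    exact single_ne_one (by simpa using hb) _ h'
  · refine mul_ne_zero (sub_inv_ne_zero (by simp [hq0', hu0, hv0]) ?_)
      (sub_inv_ne_zero (by simp [hu0, hv0]) ?_) <;>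
    · rw [hua, hvb]
      try rw [hqF]
      simp only [single_inv, HahnSeries.single_pow, HahnSeries.single_mul_single]
      exact single_ne_one (by simpa using ha) _
  · refine mul_ne_zero (sub_inv_ne_zero (by simp [hq0', hu0, hv0]) ?_)
      (sub_inv_ne_zero (by simp [hu0, hv0]) ?_) <;>
    · rw [hua, hvb]
      try rw [hqF]
      simp only [HahnSeries.single_pow, HahnSeries.single_mul_single]
      exact single_ne_one (by simpa using ha) _

end Center
end AqAlgebra
end

/-! ### The main theorem -/

theorem proposition2p1 {K : Type*} [Field K] (q ρ : K) (hq0 : q ≠ 0)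
    (hq : ∀ n : ℕ, 0 < n → q ^ n ≠ 1) (hρ : ρ ≠ 0)
    (u v : LaurentSeries K)
    (hu : u = AqAlgebra.varInv K ∨ u = AqAlgebra.var K)
    (hv : v = AqAlgebra.varInv K ∨ v = AqAlgebra.var K) :
    (∀ ε : ℤˣ,
      ⁅AqAlgebra.inFst (AqAlgebra.Delta q ρ u),
        AqAlgebra.inSnd (AqAlgebra.currentW q ρ ε v)⁆ = 0 ∧
      ⁅AqAlgebra.inFst (AqAlgebra.Delta q ρ u),
        AqAlgebra.inSnd (AqAlgebra.currentG q ρ ε v)⁆ = 0) ∧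
    ∀ n : ℤ, (AqAlgebra.Delta q ρ u).coeff n ∈ Subalgebra.center K (AqAlgebra.Aq q ρ) := by
  have h := AqAlgebra.commute_Delta q ρ hq0 hq hρ u v hu hv
  refine ⟨fun ε => ⟨(h ε).1.lie_eq, (h ε).2.lie_eq⟩, fun n => ?_⟩
  have hqs : q + q⁻¹ ≠ 0 := by
    intro h
    apply hq 4 (by norm_num)
    field_simp at h
    linear_combination (q ^ 2 - 1) * h
  have hv1 : v = AqAlgebra.varInv K * HahnSeries.C 1 ∨ v = AqAlgebra.var K * HahnSeries.C 1 := by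
    simpa using hv
  have sv := inv_ne_zero (AqAlgebra.spectral_ne_zero q 1 hq0 hqs one_ne_zero v hv1)
  have ov := AqAlgebra.one_le_orderTop_spectral_inv q 1 hq0 one_ne_zero v hv1
  -- Each generator is a coefficient datum of a current in `v`, and `v` is independent of the
  -- variable of Δ, so commutation may be compared coefficient by coefficient.
  refine AqAlgebra.mem_center_of_commute_gen q ρ _ fun g => ?_
  rcases g with ⟨ε, k⟩ | ⟨ε, k⟩
  · exact AqAlgebra.commute_of_commute_currentAt _ (fun k => AqAlgebra.gen q ρ (.W ε k)) _ sv ov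
      (AqAlgebra.coeff_commute_of_commute (h ε).1 n) k
  · exact AqAlgebra.commute_of_commute_currentAt _ (fun k => AqAlgebra.gen q ρ (.G ε k)) _ sv ov
      (AqAlgebra.coeff_commute_of_commute (h ε).2 n) k
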